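/- Let $1\le k\le N$, and let $L$ be the Laplacian of the complete graph on vertices $1,\dots,N+1$ with one indeterminate $a_e$ per undirected edge ($L_{uv}=-a_{uv}$ for $u\ne v$, $L_{uu}=\sum_{v\neq u}a_{uv}$). The first $m=k+1$ vertices are marked. For a matrix $M$ let $M_{U,W}$ be $M$ with the rows in $U$ and the columns in $W$ removed. For $r,c\in[k+1]$ put $M=L_{r,c}$, and consider, for an index $j'\in[k]$, column expansion identity $j'$: $$\det(M)\det(M_{[k],[k]})=\sum_{i=1}^k(-1)^{i+j'}\det(M_{[k]\setminus\{i\},[k]\setminus\{j'\}})\det(M_{\{i\},\{j'\}}).$$ Let $j\ne c$ be the marked vertex indexing column $j'$ of $M$, that is, $j=j'$ if $j'<c$ and $j=j'+1$ if $j'\ge c$. A spanning forest $F$ is compatible with a set partition $P$ of the marked vertices (written $F\sim P$) if there is a bijection between the trees of $F$ and the parts of $P$ such that each marked vertex lies in the tree corresponding to its part; isolated vertices count as trees. Every determinant above is a unique integer combination of the polynomials $\sum_{F\sim P}\prod_{e\in F}a_e$; replacing each of these polynomials by the symbol $P$ and expanding the products turns each side of the identity into a formal integer combination of ordered pairs $AB$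 of set partitions of the marked vertices ($A$ coming from the first and $B$ from the second determinant of each product). Let $L_{r,c}(j')$ be the formal combination obtained from the right-hand side. An $AB$ pair is a pair of set partitions of the marked vertices in which $A$ has $m-1$ parts and $B$ has $2$ parts. Call it a permissible monomial (for $c$ and $j$) if for some marked vertex $\ell\neq j$ (possibly $\ell=c$), $\{j,\ell\}$ is a part of $A$ and all other parts of $A$ are singletons, while in $B$ the vertex $j$ is in one part and $c$ and $\ell$ are both in the other. Then: 1. $L_{c,c}(j')$ consists of exactly one copy of each permissible monomial and nothing else. 2. The forest identity does not depend on the removed row: for every $r\in[k+1]$, $L_{r,c}(j')$ is $(-1)^{r+c}$ times the sum of all permissible monomials, each taken once, and the left-hand side is $(-1)^{r+c}$ times the single monomial $(1,1,\dots,1)(1,2,\dots,m)$, where $(1,1,\dots,1)$ is the partition with one part and $(1,2,\dots,m)$ the partition into singletons. So after cancelling the common sign all choices of $r$ give the same identity. 3. Consequently, for every graph $G$ on the $N+1$ vertices, $$(1,1,\dots,1)\,(1,2,\dots,m)=\sum_{AB\text{ permissible}}A\,B,$$ where each partition $P$ now denotes the spanning forest polynomial $\sum_{F\sim P}\prod_{e\notin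 F}a_e$ of $G$, the sum being over spanning forests $F$ of $G$ and the product over edges of $G$ not in $F$. -/

import Mathlib

open scoped BigOperators

noncomputable section

namespace ColumnExpansion

/-! ### Determinants of submatrices and the column expansion identities -/

section Matrices

variable {R : Type*} [CommRing R] {N : ℕ}

/-- `minor M U W` is `det (M_{U,W})`, where `M_{U,W}` is `M` with the rows in `U` and the columns
in `W` removed, the remaining rows and columns being kept in increasing order.  Only sets `U`, `W`
of the same size are meant (the value is set to `0` otherwise). -/
def minor (M : Matrix (Fin N) (Fin N) R) (U W : Finset (Fin N)) : R :=
  if h : Wᶜ.card = Uᶜ.card then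
    (M.submatrix (Uᶜ.orderEmbOfFin rfl) (Wᶜ.orderEmbOfFin h)).det
  else 0

/-- The initial segment `[k]` of the index set. -/
def initialSeg (k N : ℕ) : Finset (Fin N) := Finset.univ.filter (fun i => i.val < k)

/-- `det (M_{i,j})`: the first factor of the `i`-th term of column expansion identity `j`. -/
def firstFactor (M : Matrix (Fin N) (Fin N) R) {k : ℕ} (h : k ≤ N) (i j : Fin k) : R :=
  minor M {Fin.castLE h i} {Fin.castLE h j}

/-- `det (M_{[k]∖{i},[k]∖{j}})`: the second factor of the `i`-th term of column expansion
identity `j`, which is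
`det M * det (M_{[k],[k]}) = ∑ i, (-1)^(i+j) * det (M_{i,j}) * det (M_{[k]∖{i},[k]∖{j}})`. -/
def secondFactor (M : Matrix (Fin N) (Fin N) R) {k : ℕ} (h : k ≤ N) (i j : Fin k) : R :=
  minor M (initialSeg k N \ {Fin.castLE h i}) (initialSeg k N \ {Fin.castLE h j})

end Matrices

/-! ### Laplacians -/

/-- The Laplacian of a weighted directed graph, `a i j` being the weight of the edge `i → j`. -/
def laplacian {V R : Type*} [Fintype V] [DecidableEq V] [CommRing R] (a : V → V → R) :
    Matrix V V R :=
  Matrix.of fun i j => if i = j then ∑ v ∈ Finset.univ.erase i, a i v else - a i j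

/-- The Laplacian of the complete graph on `Fin n`, with one variable for each undirected edge. -/
def completeLaplacian (n : ℕ) :
    Matrix (Fin n) (Fin n) (MvPolynomial (Sym2 (Fin n)) ℤ) :=
  laplacian fun i j => MvPolynomial.X s(i, j)

/-- `L_{r,c}`: the Laplacian of the complete graph on `N + 1` vertices, of which the first `k + 1`
are marked, with the row of the marked vertex `r` and the column of the marked vertex `c`
removed. -/
def reducedLaplacian {k N : ℕ} (h : k ≤ N) (r c : Fin (k + 1)) :
    Matrix (Fin N) (Fin N) (MvPolynomial (Sym2 (Fin (N + 1))) ℤ) :=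
  (completeLaplacian (N + 1)).submatrix
    (Fin.castLE (Nat.succ_le_succ h) r).succAbove (Fin.castLE (Nat.succ_le_succ h) c).succAbove

/-! ### Set partitions of the marked vertices and spanning forest polynomials -/

/-- Set partitions of the set of `m` marked vertices. -/
abbrev MarkedPartition (m : ℕ) := Finpartition (Finset.univ : Finset (Fin m))

/-- A set `F` of edges on the vertex set `Fin n` (whose first `m` vertices are marked) is a spanning
forest compatible with `P`: it is acyclic, and there is a bijection between the parts of `P` and
the trees (the connected components, isolated vertices included) such that each marked vertex lies
in the tree that corresponds to its part. -/
def IsCompatibleForest {m n : ℕ} (h : m ≤ n) (P : MarkedPartition m)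
    (F : Finset (Sym2 (Fin n))) : Prop :=
  (SimpleGraph.fromEdgeSet (F : Set (Sym2 (Fin n)))).IsAcyclic ∧
    ∃ φ : {p // p ∈ P.parts} ≃
        (SimpleGraph.fromEdgeSet (F : Set (Sym2 (Fin n)))).ConnectedComponent,
      ∀ p : {p // p ∈ P.parts}, ∀ v ∈ p.1,
        (SimpleGraph.fromEdgeSet (F : Set (Sym2 (Fin n)))).connectedComponentMk
          (Fin.castLE h v) = φ p

open Classical in
/-- The spanning forests of `G` compatible with `P`, as sets of edges. -/
def compatibleForests {m n : ℕ} (h : m ≤ n) (G : SimpleGraph (Fin n)) (P : MarkedPartition m) :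
    Finset (Finset (Sym2 (Fin n))) :=
  G.edgeFinset.powerset.filter (IsCompatibleForest h P)

open Classical in
/-- The spanning forest polynomial `∑_{F ∼ P} ∏_{e ∉ F} a_e` of `G` and `P`. -/
def spanningForestPoly {m n : ℕ} (h : m ≤ n) (G : SimpleGraph (Fin n)) (P : MarkedPartition m) :
    MvPolynomial (Sym2 (Fin n)) ℤ :=
  ∑ F ∈ compatibleForests h G P, ∏ e ∈ G.edgeFinset \ F, MvPolynomial.X e

/-- The polynomial `∑_{F ∼ P} ∏_{e ∈ F} a_e` of the complete graph.  This is the form in which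
spanning forests appear in minors of the Laplacian. -/
def forestSum {m n : ℕ} (h : m ≤ n) (P : MarkedPartition m) : MvPolynomial (Sym2 (Fin n)) ℤ :=
  ∑ F ∈ compatibleForests h (⊤ : SimpleGraph (Fin n)) P, ∏ e ∈ F, MvPolynomial.X e

/-- The formal integer combination `α` of set partitions of the marked vertices becomes the
polynomial `p` when each set partition is replaced by its sum of spanning forests. -/
def IsForestExpansion {m n : ℕ} (h : m ≤ n) (α : MarkedPartition m → ℤ)
    (p : MvPolynomial (Sym2 (Fin n)) ℤ) : Prop :=
  p = ∑ P, MvPolynomial.C (α P) * forestSum h P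

/-! ### The two sides of the spanning forest identities, as formal sums of pairs of partitions -/

/-- Formal integer combinations of (ordered) pairs of set partitions of `m` marked vertices; the
value at a pair is its coefficient. -/
abbrev PairSum (m : ℕ) := MarkedPartition m × MarkedPartition m → ℤ

/-- The formal bilinear product of two formal combinations of set partitions. -/
def pairProduct {m : ℕ} (α β : MarkedPartition m → ℤ) : PairSum m :=
  fun AB => α AB.1 * β AB.2

/-- `T` is the left hand side `det M * det (M_{[k],[k]})`, `M = L_{r,c}`, written in terms of pairs
of set partitions by expanding each determinant in spanning forests. -/
def IsLeftSide {k N : ℕ} (h : k ≤ N) (r c : Fin (k + 1)) (T : PairSum (k + 1)) : Prop :=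
  ∃ α β : MarkedPartition (k + 1) → ℤ,
    IsForestExpansion (Nat.succ_le_succ h) α (reducedLaplacian h r c).det ∧
    IsForestExpansion (Nat.succ_le_succ h) β
      (minor (reducedLaplacian h r c) (initialSeg k N) (initialSeg k N)) ∧
    T = pairProduct α β

/-- `S` is the right hand side `L_{r,c}(j)` of column expansion identity `j` for `M = L_{r,c}`,
written in terms of pairs of set partitions by expanding each determinant in spanning forests: in
each term the `A` partitions come from `det (M_{[k]∖{i},[k]∖{j}})` and the `B` partitions from
`det (M_{i,j})`. -/
def IsRightSide {k N : ℕ} (h : k ≤ N) (r c : Fin (k + 1)) (j : Fin k) (S : PairSum (k + 1)) :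
    Prop :=
  ∃ α β : Fin k → MarkedPartition (k + 1) → ℤ,
    (∀ i, IsForestExpansion (Nat.succ_le_succ h) (α i)
      (secondFactor (reducedLaplacian h r c) h i j)) ∧
    (∀ i, IsForestExpansion (Nat.succ_le_succ h) (β i)
      (firstFactor (reducedLaplacian h r c) h i j)) ∧
    S = ∑ i : Fin k, (-1 : ℤ) ^ (i.val + j.val) • pairProduct (α i) (β i)

/-! ### Permissible monomials -/

/-- An `AB` pair on `m` marked vertices: `A` has `m - 1` parts and `B` has `2` parts. -/
def IsABPair {m : ℕ} (AB : MarkedPartition m × MarkedPartition m) : Prop :=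
  AB.1.parts.card + 1 = m ∧ AB.2.parts.card = 2

/-- Permissible monomials for the marked vertices `c` and `j`. -/
def IsPermissible {m : ℕ} (c j : Fin m) (AB : MarkedPartition m × MarkedPartition m) : Prop :=
  IsABPair AB ∧
    ∃ l : Fin m, l ≠ j ∧
      ({j, l} ∈ AB.1.parts ∧ ∀ v, v ≠ j → v ≠ l → {v} ∈ AB.1.parts) ∧
      ∃ p ∈ AB.2.parts, ∃ q ∈ AB.2.parts, p ≠ q ∧ j ∈ p ∧ c ∈ q ∧ l ∈ q

open Classical in
/-- The formal sum of one copy of each permissible monomial. -/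
def permissibleSum {m : ℕ} (c j : Fin m) : PairSum m :=
  fun AB => if IsPermissible c j AB then 1 else 0

/-- The partition `(1,1,…,1)` with a single part. -/
def onePart (k : ℕ) : MarkedPartition (k + 1) :=
  Finpartition.indiscrete (Finset.univ_nonempty.ne_empty)

/-- The partition `(1,2,…,m)` into singletons. -/
def allSingletons (m : ℕ) : MarkedPartition m := ⊥

open Classical in
/-- The single monomial `(1,1,…,1)(1,2,…,m)`. -/
def leftMonomial (k : ℕ) : PairSum (k + 1) :=
  fun AB => if AB = (onePart k, allSingletons (k + 1)) then 1 else 0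

end ColumnExpansion

end

open scoped BigOperators

noncomputable section

namespace ColumnExpansion

/-! ### Rooted maps and determinants -/

section RootedMaps

variable {V : Type*} [DecidableEq V]

/-! The proof is an all-minors matrix-tree theorem arranged so that signs appear only at the end. In
place of a minor, take the full Laplacian with the rows of a root set `Q` replaced by unit rows and
one further change: row `x ∈ Q` becomes `e_z`. Row `v` of the Laplacian is the sum over `t` of
`a_{vt} (e_v - e_t)`, so multilinearity turns the determinant into a sum over maps `f`. The terms
with `f` not rooted at `Q` vanish, and the others have determinant 1 or 0 according to whether the
orbit of `z` ends at `x`. Rooted maps correspond to forests with one root of `Q` per tree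
(`rootedMinor_eq_sum_forests`), and grouping forests by the partition they induce gives 0/1
coefficients (`isForestExpansion_rootedMinor`). These coefficients are unique because distinct
forests have distinct monomials (`IsForestExpansion.unique`).

Write `u` for the marked vertex of row `i` and `B_r` for the part of `r` in `B`. The second factor
(`A` side) is a rooted minor with all marked vertices except `u` as roots, up to sign; for an `A`
that pairs `j` with `l` its coefficient is `[u = j] - [u = l]`. The first factor (`B` side) is a
difference of two rooted minors with roots `r, u`; up to sign its coefficient is `[u ∉ B_r] ([c ∈
B_r] - [j ∈ B_r])` when `B` has two parts. The sum over `u` is `([l ∈ B_r] - [j ∈ B_r]) ([c ∈ B_r] -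
[j ∈ B_r])`, which is 1 when `B` separates `j` from both `c` and `l`, and 0 otherwise, whatever `r`
is (`sum_secondCoeff_mul_firstCoeff`). Of the signs, only `(-1)^(r+c)` survives.

The polynomial identity then follows from the column expansion identity, itself Cramer's rule
(`det_mul_minor_initialSeg`). Substituting `a_e⁻¹` on the edges of `G` and 0 elsewhere, and clearing
denominators, carries it from the complete graph to `G`. -/

/-- `f` fixes the points of `Q`, and every orbit of `f` reaches `Q`. -/
def IsRootedMap (Q : Finset V) (f : V → V) : Prop :=
  (∀ q ∈ Q, f q = q) ∧ ∀ v, ∃ n, f^[n] v ∈ Q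

open Classical in
/-- The number of steps that `f` needs to move `v` into `Q`. -/
def depth {Q : Finset V} {f : V → V} (hf : IsRootedMap Q f) (v : V) : ℕ := Nat.find (hf.2 v)

theorem depth_map_lt {Q : Finset V} {f : V → V} (hf : IsRootedMap Q f) {v : V} (hv : v ∉ Q) :
    depth hf (f v) < depth hf v := by
  classical
  have h := Nat.find_spec (hf.2 v)
  rcases hn : depth hf v with _ | n
  · unfold depth at hn
    rw [hn] at h
    exact absurd h hv
  · refine Nat.lt_succ_of_le (Nat.find_min' _ ?_)
    unfold depth at hn
    rw [hn] at h
    exact h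

theorem IsRootedMap.map_ne {Q : Finset V} {f : V → V} (hf : IsRootedMap Q f) {v : V}
    (hv : v ∉ Q) : f v ≠ v := fun h => by
  have := depth_map_lt hf hv
  rw [h] at this
  exact lt_irrefl _ this

omit [DecidableEq V] in
theorem IsRootedMap.iterate_eq {Q : Finset V} {f : V → V} (hf : IsRootedMap Q f) {q : V}
    (hq : q ∈ Q) (n : ℕ) : f^[n] q = q := Function.iterate_fixed (hf.1 q hq) n

omit [DecidableEq V] in
theorem reaches_map_iff {Q : Finset V} {f : V → V} (hf : IsRootedMap Q f) {x : V} (hx : x ∈ Q)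
    (v : V) : (∃ n, f^[n] (f v) = x) ↔ ∃ n, f^[n] v = x := by
  constructor
  · rintro ⟨n, hn⟩
    exact ⟨n + 1, hn⟩
  · rintro ⟨_ | n, hn⟩
    · obtain rfl : v = x := hn
      exact ⟨0, hf.1 v hx⟩
    · exact ⟨n, hn⟩

variable (R : Type*) [CommRing R]

/-- The matrix with rows `e_q` for `q ∈ Q` and `e_v - e_{f v}` for the other indices `v`. -/
def functionalMatrix (Q : Finset V) (f : V → V) : Matrix V V R :=
  Matrix.of fun v => if v ∈ Q then Pi.single v 1 else Pi.single v 1 - Pi.single (f v) 1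

variable [Fintype V]

/-- Outside `Q`, `f` strictly lowers the depth, so sorting by depth makes the matrix block
triangular, with identity blocks on the diagonal. -/
theorem det_functionalMatrix {Q : Finset V} {f : V → V} (hf : IsRootedMap Q f) :
    (functionalMatrix R Q f).det = 1 := by
  have hb : (functionalMatrix R Q f).BlockTriangular (OrderDual.toDual ∘ depth hf) := by
    intro i j hij
    replace hij : depth hf i < depth hf j := hij
    have h1 : j ≠ i := fun h => by subst h; exact lt_irrefl _ hij
    by_cases hi : i ∈ Q
    · simp [functionalMatrix, hi, h1]
    · have h2 : j ≠ f i := fun h => by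
        subst h
        exact lt_asymm hij (depth_map_lt hf hi)
      simp [functionalMatrix, hi, h1, h2]
  rw [hb.det]
  refine Finset.prod_eq_one fun a _ => (congrArg Matrix.det ?_).trans Matrix.det_one
  ext ⟨i, hi⟩ ⟨j, hj⟩
  have hij : depth hf j = depth hf i := OrderDual.toDual.injective (hj.trans hi.symm)
  by_cases hiQ : i ∈ Q
  · simp [Matrix.toSquareBlock, Matrix.toSquareBlockProp, Matrix.one_apply, functionalMatrix, hiQ,
      Pi.single_apply, eq_comm]
  · have h2 : j ≠ f i := fun h => by
      subst h
      exact (depth_map_lt hf hiQ).ne hij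
    simp [Matrix.toSquareBlock, Matrix.toSquareBlockProp, Matrix.one_apply, functionalMatrix, hiQ,
      Pi.single_apply, @eq_comm _ i j, h2]

-- The indicator `H` of the orbits that reach `x` is constant along orbits, so the matrix `E` sends
-- `H` to `e_x`. Since `det E = 1`, `H` is column `x` of the adjugate, whose entry at `z` is the
-- determinant in question.
open Classical in
theorem det_functionalMatrix_updateRow {Q : Finset V} {f : V → V} (hf : IsRootedMap Q f) {x : V}
    (hx : x ∈ Q) (z : V) :
    ((functionalMatrix R Q f).updateRow x (Pi.single z 1)).det =
      if ∃ n, f^[n] z = x then 1 else 0 := by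
  set E := functionalMatrix R Q f with hE
  let H : V → R := fun v => if ∃ n, f^[n] v = x then 1 else 0
  have hH : E.mulVec H = Pi.single x 1 := by
    ext v
    by_cases hv : v ∈ Q
    · have : (∃ n, f^[n] v = x) ↔ v = x := by
        simp [hf.iterate_eq hv]
      have hrow : E v = Pi.single v 1 := if_pos hv
      change E v ⬝ᵥ H = _
      rw [hrow, single_dotProduct]
      simp only [one_mul, H, this, Pi.single_apply]
    · have hvx : v ≠ x := fun h => hv (h ▸ hx)
      have hrow : E v = Pi.single v 1 - Pi.single (f v) 1 := if_neg hv
      change E v ⬝ᵥ H = _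
      rw [hrow, sub_dotProduct, single_dotProduct, single_dotProduct]
      simp [H, reaches_map_iff hf hx, hvx]
  have h : E.adjugate.mulVec (E.mulVec H) = H := by
    rw [Matrix.mulVec_mulVec, Matrix.adjugate_mul, hE, det_functionalMatrix R hf, one_smul,
      Matrix.one_mulVec]
  rw [← Matrix.adjugate_apply, ← show H z = (if ∃ n, f^[n] z = x then 1 else 0) from rfl, ← h, hH]
  simp

/-- The vertices whose orbits avoid `Q` are closed under `f` and do not include `x`. They give a
diagonal block with zero row sums, hence a singular one. -/
theorem det_functionalMatrix_updateRow_eq_zero [IsDomain R] {Q : Finset V} {f : V → V}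
    (hf : ¬ ∀ v, ∃ n, f^[n] v ∈ Q) {x : V} (hx : x ∈ Q) (g : V → R) :
    ((functionalMatrix R Q f).updateRow x g).det = 0 := by
  classical
  let p : V → Prop := fun v => ∃ n, f^[n] v ∈ Q
  have hpf : ∀ i, ¬ p i → i ∉ Q ∧ ¬ p (f i) := fun i hi =>
    ⟨fun h => hi ⟨0, h⟩, fun ⟨n, hn⟩ => hi ⟨n + 1, hn⟩⟩
  have hrow : ∀ i, ¬ p i → (functionalMatrix R Q f).updateRow x g i =
      Pi.single i 1 - Pi.single (f i) 1 := fun i hi => by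
    have hiQ := (hpf i hi).1
    have hix : i ≠ x := fun h => hiQ (h ▸ hx)
    ext j
    rw [Matrix.updateRow_ne hix]
    simp [functionalMatrix, hiQ]
  rw [Matrix.twoBlockTriangular_det _ p]
  · refine mul_eq_zero_of_right _ (Matrix.exists_mulVec_eq_zero_iff.1 ⟨fun _ => 1, ?_, ?_⟩)
    · push Not at hf
      obtain ⟨v, hv⟩ := hf
      intro h
      exact one_ne_zero (congrFun h ⟨v, fun ⟨n, hn⟩ => hv n hn⟩)
    · ext ⟨i, hi⟩
      have h1 : ∀ t : V, ¬ p t → ∑ j : {a // ¬ p a}, (Pi.single t 1 : V → R) j = 1 := fun t ht => by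
        rw [Finset.sum_eq_single (⟨t, ht⟩ : {a // ¬ p a})]
        · simp
        · rintro ⟨b, hb⟩ _ hne
          exact Pi.single_eq_of_ne (fun h => hne (Subtype.ext h)) _
        · simp
      simp only [Matrix.mulVec, dotProduct, Matrix.toSquareBlockProp_def, Matrix.of_apply, hrow i hi,
        Pi.sub_apply, mul_one, Finset.sum_sub_distrib, h1 i hi, h1 _ (hpf i hi).2, sub_self,
        Pi.zero_apply]
  · intro i hi j hj
    have h1 : j ≠ i := fun h => hi (h ▸ hj)
    have h2 : j ≠ f i := fun h => (hpf i hi).2 (h ▸ hj)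
    rw [hrow i hi]
    simp [h1, h2]

variable {R}

/-- The determinant of the Laplacian after replacing the rows `q ∈ Q` by `e_q`, and row `x` by
`e_z`. -/
def rootedMinor (a : V → V → R) (Q : Finset V) (x z : V) : R :=
  ((Matrix.of fun v => if v ∈ Q then Pi.single v 1 else laplacian a v).updateRow x
    (Pi.single z 1)).det

theorem laplacian_row (a : V → V → R) (v : V) :
    laplacian a v = ∑ t, a v t • ((Pi.single v 1 : V → R) - Pi.single t 1) := by
  ext w
  simp only [laplacian, Matrix.of_apply, Finset.sum_apply, Pi.smul_apply, Pi.sub_apply, smul_eq_mul,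
    mul_sub, Finset.sum_sub_distrib]
  by_cases h : v = w
  · subst h
    rw [← Finset.add_sum_erase Finset.univ _ (Finset.mem_univ v)]
    simp [Pi.single_apply]
  · simp [h, Pi.single_apply, Ne.symm h]

open Classical in
theorem rootedMinor_eq_sum_maps [IsDomain R] (a : V → V → R) {Q : Finset V} {x : V} (hx : x ∈ Q)
    (z : V) :
    rootedMinor a Q x z = ∑ f : V → V with IsRootedMap Q f,
      if ∃ n, f^[n] z = x then ∏ v ∈ Qᶜ, a v (f v) else 0 := by
  -- The singleton index sets on `Q` make every choice function fix `Q`, so only the orbit condition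
  -- can fail for a term of the expansion.
  let A : V → Finset V := fun v => if v ∈ Q then {v} else Finset.univ
  let g : V → V → V → R := fun v t =>
    if v ∈ Q then (if v = x then Pi.single z 1 else Pi.single v 1)
    else a v t • (Pi.single v 1 - Pi.single t 1)
  have h1 : rootedMinor a Q x z = Matrix.detRowAlternating fun v => ∑ t ∈ A v, g v t := by
    unfold rootedMinor
    change Matrix.detRowAlternating _ = _
    congr 1
    ext v w
    by_cases hv : v ∈ Q
    · by_cases hvx : v = x
      · subst hvx
        simp [A, g, hv]
      · simp [A, g, hv, hvx]
    · have hvx : v ≠ x := fun h => hv (h ▸ hx)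
      simp [A, g, hv, hvx, laplacian_row]
  rw [h1]
  refine (MultilinearMap.map_sum_finset Matrix.detRowAlternating.toMultilinearMap g A).trans ?_
  have h2 : ∀ f ∈ Fintype.piFinset A, Matrix.detRowAlternating (fun v => g v (f v)) =
      (∏ v ∈ Qᶜ, a v (f v)) * ((functionalMatrix R Q f).updateRow x (Pi.single z 1)).det := by
    intro f _
    have : (∏ v ∈ Qᶜ, a v (f v)) = ∏ v, if v ∈ Q then 1 else a v (f v) := by
      rw [Finset.prod_ite]
      simp [Finset.compl_eq_univ_sdiff, Finset.sdiff_eq_filter]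
    rw [this, ← Matrix.det_mul_column]
    change Matrix.det _ = _
    congr 1
    ext v w
    by_cases hv : v ∈ Q
    · by_cases hvx : v = x
      · subst hvx
        simp [g, hv]
      · simp [g, hv, hvx, functionalMatrix]
    · have hvx : v ≠ x := fun h => hv (h ▸ hx)
      simp [g, hv, hvx, functionalMatrix]
  refine (Finset.sum_congr rfl h2).trans ?_
  symm
  apply Finset.sum_subset_zero_on_sdiff
  · intro f hf
    have hf := (Finset.mem_filter.1 hf).2
    refine Fintype.mem_piFinset.2 fun v => ?_
    by_cases hv : v ∈ Q
    · simp [A, hv, hf.1 v hv]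
    · simp [A, hv]
  · intro f hf
    rw [Finset.mem_sdiff, Finset.mem_filter, Fintype.mem_piFinset] at hf
    rw [det_functionalMatrix_updateRow_eq_zero R _ hx, mul_zero]
    refine fun h => hf.2 ⟨Finset.mem_univ _, fun q hq => ?_, h⟩
    simpa [A, hq] using hf.1 q
  · intro f hf
    rw [det_functionalMatrix_updateRow R (Finset.mem_filter.1 hf).2 hx]
    simp

end RootedMaps

/-! ### Rooted maps and rooted forests -/

section RootedForests

open SimpleGraph

variable {V : Type*}

/-- `F` is the edge set of a forest, each tree of which contains exactly one point of `Q`. -/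
structure IsRootedForest (Q : Finset V) (F : Finset (Sym2 V)) : Prop where
  not_isDiag : ∀ e ∈ F, ¬ e.IsDiag
  isAcyclic : (fromEdgeSet (F : Set (Sym2 V))).IsAcyclic
  exists_root : ∀ v, ∃ q ∈ Q, (fromEdgeSet (F : Set (Sym2 V))).Reachable v q
  root_unique : ∀ q ∈ Q, ∀ q' ∈ Q, (fromEdgeSet (F : Set (Sym2 V))).Reachable q q' → q = q'

theorem reachable_induction {G : SimpleGraph V} {p : V → Prop}
    (hp : ∀ u w, G.Adj u w → p u → p w) {u w : V} (h : G.Reachable u w) (hu : p u) : p w := by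
  obtain ⟨W⟩ := h
  induction W with
  | nil => exact hu
  | cons hadj _ ih => exact ih (hp _ _ hadj hu)

variable [DecidableEq V] [Fintype V]

/-- The edges `v — f v` for `v ∉ Q`. -/
def mapEdges (Q : Finset V) (f : V → V) : Finset (Sym2 V) := Qᶜ.image fun v => s(v, f v)

theorem mapEdges_adj {Q : Finset V} {f : V → V} {u w : V} :
    (fromEdgeSet (mapEdges Q f : Set (Sym2 V))).Adj u w ↔
      (u ∉ Q ∧ f u = w ∨ w ∉ Q ∧ f w = u) ∧ u ≠ w := by
  rw [fromEdgeSet_adj]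
  refine and_congr_left fun _ => ?_
  simp only [mapEdges, Finset.coe_image, Set.mem_image, Finset.mem_coe, Finset.mem_compl,
    Sym2.eq_iff]
  constructor
  · rintro ⟨v, hv, ⟨rfl, rfl⟩ | ⟨rfl, rfl⟩⟩
    · exact Or.inl ⟨hv, rfl⟩
    · exact Or.inr ⟨hv, rfl⟩
  · rintro (⟨hu, rfl⟩ | ⟨hw, rfl⟩)
    · exact ⟨u, hu, Or.inl ⟨rfl, rfl⟩⟩
    · exact ⟨w, hw, Or.inr ⟨rfl, rfl⟩⟩

namespace IsRootedMap

variable {Q : Finset V} {f : V → V} (hf : IsRootedMap Q f)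
include hf

omit [Fintype V] in
theorem not_periodic {v : V} (hv : v ∉ Q) (n : ℕ) : f^[n + 1] v ≠ v := by
  intro h
  have hle : ∀ m, depth hf (f^[m] (f v)) ≤ depth hf (f v) := fun m => by
    induction m with
    | zero => exact le_rfl
    | succ m ih =>
      rw [Function.iterate_succ_apply']
      by_cases hm : f^[m] (f v) ∈ Q
      · rw [hf.1 _ hm]; exact ih
      · exact (depth_map_lt hf hm).le.trans ih
  have := hle n
  rw [← Function.iterate_succ_apply, h] at this
  exact absurd (depth_map_lt hf hv) (not_lt.2 this)

theorem reachable_map (v : V) : (fromEdgeSet (mapEdges Q f : Set (Sym2 V))).Reachable v (f v) := by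
  by_cases hv : v ∈ Q
  · rw [hf.1 v hv]
  · exact Adj.reachable (mapEdges_adj.2 ⟨Or.inl ⟨hv, rfl⟩, (hf.map_ne hv).symm⟩)

theorem reachable_iterate (v : V) (n : ℕ) :
    (fromEdgeSet (mapEdges Q f : Set (Sym2 V))).Reachable v (f^[n] v) := by
  induction n with
  | zero => exact Reachable.refl _
  | succ n ih =>
    rw [Function.iterate_succ_apply']
    exact ih.trans (hf.reachable_map _)

theorem reachable_iff {x : V} (hx : x ∈ Q) (z : V) :
    (fromEdgeSet (mapEdges Q f : Set (Sym2 V))).Reachable z x ↔ ∃ n, f^[n] z = x := by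
  constructor
  · intro h
    refine reachable_induction (p := fun v => ∃ n, f^[n] v = x) ?_ h.symm ⟨0, rfl⟩
    intro u w huw
    obtain ⟨⟨_, rfl⟩ | ⟨_, rfl⟩, _⟩ := mapEdges_adj.1 huw
    · exact (reaches_map_iff hf hx u).2
    · exact (reaches_map_iff hf hx w).1
  · rintro ⟨n, rfl⟩
    exact hf.reachable_iterate z n

theorem isRootedForest : IsRootedForest Q (mapEdges Q f) where
  not_isDiag e he := by
    obtain ⟨v, hv, rfl⟩ := Finset.mem_image.1 he
    rw [Sym2.mk_isDiag_iff]
    exact (hf.map_ne (Finset.mem_compl.1 hv)).symm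
  isAcyclic := by
    rw [isAcyclic_iff_forall_isBridge]
    intro e he
    rw [edgeSet_fromEdgeSet] at he
    obtain ⟨v, hv, rfl⟩ := Finset.mem_image.1 he.1
    rw [Finset.mem_compl] at hv
    rw [isBridge_iff]
    intro h
    -- Once the edge from `v` to `f v` is deleted, the set of vertices whose orbit passes through
    -- `v` is closed under adjacency. It contains `v`; were it to contain `f v`, then `v` would be
    -- periodic.
    obtain ⟨n, hn⟩ := reachable_induction (p := fun u => ∃ n, f^[n] u = v) (by
      intro u w huw
      rw [deleteEdges_adj, mapEdges_adj] at huw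
      obtain ⟨⟨⟨_, rfl⟩ | ⟨_, rfl⟩, _⟩, hne⟩ := huw
      · rintro ⟨_ | n, hn⟩
        · obtain rfl : u = v := hn
          exact absurd rfl hne
        · exact ⟨n, hn⟩
      · rintro ⟨n, hn⟩
        exact ⟨n + 1, hn⟩) h ⟨0, rfl⟩
    exact hf.not_periodic hv n hn
  exists_root v := by
    obtain ⟨n, hn⟩ := hf.2 v
    exact ⟨_, hn, hf.reachable_iterate v n⟩
  root_unique q hq q' hq' h := by
    obtain ⟨n, hn⟩ := (hf.reachable_iff hq' q).1 h
    rwa [hf.iterate_eq hq] at hn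

theorem injOn_edge : Set.InjOn (fun v => s(v, f v)) (Qᶜ : Finset V) := by
  intro v hv w hw h
  rw [Finset.mem_coe, Finset.mem_compl] at hv hw
  rcases Sym2.eq_iff.1 h with ⟨h1, _⟩ | ⟨h1, h2⟩
  · exact h1
  · refine absurd ?_ (hf.not_periodic hv 1)
    change f (f v) = v
    rw [h2, h1]

theorem eq_of_mapEdges_eq {g : V → V} (hg : IsRootedMap Q g)
    (h : mapEdges Q f = mapEdges Q g) : f = g := by
  by_contra hne
  obtain ⟨v, hv⟩ := Function.ne_iff.1 hne
  have hQ : ∀ v, f v ≠ g v → v ∉ Q := fun v hv hvQ => hv ((hf.1 v hvQ).trans (hg.1 v hvQ).symm)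
  -- The edge from `v` to `f v` must also come from `g`, and not from `v`, so `g (f v) = v`. Since
  -- `f (f v) ≠ v`, the disagreement moves on along the `f`-orbit and would survive into `Q`, where
  -- both maps are the identity.
  have hstep : ∀ v, f v ≠ g v → f (f v) ≠ g (f v) := by
    intro v hv
    have hvQ := hQ v hv
    have hmem : s(v, f v) ∈ mapEdges Q g := by
      rw [← h]
      exact Finset.mem_image.2 ⟨v, Finset.mem_compl.2 hvQ, rfl⟩
    obtain ⟨u, _, hu⟩ := Finset.mem_image.1 hmem
    rcases Sym2.eq_iff.1 hu with ⟨rfl, h2⟩ | ⟨h1, h2⟩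
    · exact absurd h2.symm hv
    · rw [← h1, h2, h1]
      exact hf.not_periodic hvQ 1
  have hall : ∀ n, f (f^[n] v) ≠ g (f^[n] v) := fun n => by
    induction n with
    | zero => exact hv
    | succ n ih =>
      rw [Function.iterate_succ_apply']
      exact hstep _ ih
  obtain ⟨n, hn⟩ := hf.2 v
  exact hQ _ (hall n) hn

end IsRootedMap

/-- The map moves each vertex outside `Q` to a neighbour closer to the root of its tree. -/
theorem IsRootedForest.exists_map {Q : Finset V} {F : Finset (Sym2 V)} (hF : IsRootedForest Q F) :
    ∃ f, IsRootedMap Q f ∧ mapEdges Q f = F := by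
  set G := fromEdgeSet (F : Set (Sym2 V)) with hG
  choose root hrQ hroot using hF.exists_root
  have hnext : ∀ q v, q ≠ v → G.Reachable v q → ∃ w, G.Adj v w ∧ G.dist w q < G.dist v q := by
    intro q v hne hr
    obtain ⟨W, hW⟩ := hr.exists_walk_length_eq_dist
    cases W with
    | nil => exact absurd rfl hne
    | cons h p =>
      refine ⟨_, h, ?_⟩
      rw [← hW, Walk.length_cons]
      exact Nat.lt_succ_of_le (dist_le p)
  have hadj : ∀ v, v ∉ Q → ∃ w, G.Adj v w ∧ G.dist w (root v) < G.dist v (root v) :=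
    fun v hv => hnext _ v (fun h => hv (h ▸ hrQ v)) (hroot v)
  let f : V → V := fun v => if hv : v ∈ Q then v else (hadj v hv).choose
  have hf1 : ∀ v, v ∉ Q → G.Adj v (f v) ∧ G.dist (f v) (root v) < G.dist v (root v) := by
    intro v hv
    simp only [f, hv, dite_false]
    exact (hadj v hv).choose_spec
  have hrootf : ∀ v, v ∉ Q → root (f v) = root v := fun v hv =>
    hF.root_unique _ (hrQ _) _ (hrQ _)
      ((hroot (f v)).symm.trans ((hf1 v hv).1.symm.reachable.trans (hroot v)))
  have hf : IsRootedMap Q f := by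
    refine ⟨fun q hq => by simp [f, hq], fun v => ?_⟩
    induction hd : G.dist v (root v) using Nat.strong_induction_on generalizing v with
    | _ d ih =>
      by_cases hv : v ∈ Q
      · exact ⟨0, hv⟩
      · obtain ⟨n, hn⟩ := ih _ (hd ▸ (hf1 v hv).2) (f v) (by rw [hrootf v hv])
        exact ⟨n + 1, hn⟩
  have hsub : mapEdges Q f ⊆ F := by
    intro e he
    obtain ⟨v, hv, rfl⟩ := Finset.mem_image.1 he
    exact ((fromEdgeSet_adj _).1 (hf1 v (Finset.mem_compl.1 hv)).1).1
  refine ⟨f, hf, hsub.antisymm fun e he => ?_⟩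
  -- An edge of `F` not used by `f` would not be a bridge: its endpoints share a root, and following
  -- `f` from each of them to that root avoids the edge.
  by_contra hne
  induction e with
  | _ u w =>
    have huw : u ≠ w := fun h => hF.not_isDiag _ he (Sym2.mk_isDiag_iff.2 h)
    have hGuw : G.Adj u w := (fromEdgeSet_adj _).2 ⟨he, huw⟩
    have hbr := isAcyclic_iff_forall_isBridge.1 hF.isAcyclic (G.mem_edgeSet.2 hGuw)
    rw [isBridge_iff] at hbr
    apply hbr
    have hle : fromEdgeSet (mapEdges Q f : Set (Sym2 V)) ≤ G.deleteEdges {s(u, w)} := by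
      intro a b hab
      rw [fromEdgeSet_adj] at hab
      rw [deleteEdges_adj, hG, fromEdgeSet_adj]
      refine ⟨⟨hsub hab.1, hab.2⟩, fun h => hne ?_⟩
      rw [Set.mem_singleton_iff] at h
      rw [← h]
      exact hab.1
    obtain ⟨n, hn⟩ := hf.2 u
    obtain ⟨m, hm⟩ := hf.2 w
    have hmono : ∀ {a b}, (fromEdgeSet (mapEdges Q f : Set (Sym2 V))).Reachable a b →
        G.Reachable a b := fun h => h.mono (fromEdgeSet_mono (by exact_mod_cast hsub))
    have heq : f^[n] u = f^[m] w := hF.root_unique _ hn _ hm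
      ((hmono (hf.reachable_iterate u n)).symm.trans
        (hGuw.reachable.trans (hmono (hf.reachable_iterate w m))))
    refine Reachable.mono hle ((hf.reachable_iterate u n).trans ?_)
    rw [heq]
    exact (hf.reachable_iterate w m).symm

open Classical in
theorem rootedMinor_eq_sum_forests {R : Type*} [CommRing R] [IsDomain R] (a : Sym2 V → R)
    {Q : Finset V} {x : V} (hx : x ∈ Q) (z : V) :
    rootedMinor (fun u v => a s(u, v)) Q x z =
      ∑ F : Finset (Sym2 V) with IsRootedForest Q F,
        if (fromEdgeSet (F : Set (Sym2 V))).Reachable z x then ∏ e ∈ F, a e else 0 := by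
  rw [rootedMinor_eq_sum_maps _ hx]
  refine Finset.sum_bij (fun f _ => mapEdges Q f) ?_ ?_ ?_ ?_
  · intro f hf
    exact Finset.mem_filter.2 ⟨Finset.mem_univ _, (Finset.mem_filter.1 hf).2.isRootedForest⟩
  · intro f hf g hg h
    exact (Finset.mem_filter.1 hf).2.eq_of_mapEdges_eq (Finset.mem_filter.1 hg).2 h
  · intro F hF
    obtain ⟨f, hf, rfl⟩ := (Finset.mem_filter.1 hF).2.exists_map
    exact ⟨f, Finset.mem_filter.2 ⟨Finset.mem_univ _, hf⟩, rfl⟩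
  · intro f hf
    have hf := (Finset.mem_filter.1 hf).2
    simp only [hf.reachable_iff hx]
    rw [mapEdges, Finset.prod_image hf.injOn_edge]

end RootedForests

/-! ### Forests compatible with a set partition of the marked vertices -/

section Partitions

open SimpleGraph

variable {m n : ℕ}

theorem mem_part_comm {P : MarkedPartition m} {u v : Fin m} : u ∈ P.part v ↔ v ∈ P.part u := by
  simp only [Finpartition.mem_part_iff_exists]
  exact exists_congr fun p => and_congr_right fun _ => and_comm

theorem mem_part_trans {P : MarkedPartition m} {u v w : Fin m} (h : v ∈ P.part u)
    (h' : w ∈ P.part v) : w ∈ P.part u := by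
  rw [Finpartition.mem_part_iff_part_eq_part _ (Finset.mem_univ _) (Finset.mem_univ _)] at *
  exact h'.trans h

theorem mem_part_self' (P : MarkedPartition m) (u : Fin m) : u ∈ P.part u :=
  P.mem_part_self.2 (Finset.mem_univ u)

theorem markedPartition_ext {P P' : MarkedPartition m} (h : ∀ u v, v ∈ P.part u ↔ v ∈ P'.part u) :
    P = P' := by
  have hpart : ∀ u, P.part u = P'.part u := fun u => Finset.ext (h u)
  have key : ∀ {P P' : MarkedPartition m}, (∀ u, P.part u = P'.part u) → P.parts ⊆ P'.parts := by
    intro P P' hpart p hp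
    obtain ⟨u, hu⟩ := P.nonempty_of_mem_parts hp
    rw [← P.part_eq_of_mem hp hu, hpart u]
    exact P'.part_mem.2 (Finset.mem_univ _)
  exact Finpartition.ext ((key hpart).antisymm (key fun u => (hpart u).symm))

/-- Replaces the bijection between parts and trees by conditions on reachability alone, the form in
which rooted forests are compared with partitions. -/
theorem isCompatibleForest_iff {h : m ≤ n} {P : MarkedPartition m} {F : Finset (Sym2 (Fin n))} :
    IsCompatibleForest h P F ↔ (fromEdgeSet (F : Set (Sym2 (Fin n)))).IsAcyclic ∧
      (∀ v, ∃ u, (fromEdgeSet (F : Set (Sym2 (Fin n)))).Reachable v (Fin.castLE h u)) ∧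
      ∀ u w, (fromEdgeSet (F : Set (Sym2 (Fin n)))).Reachable (Fin.castLE h u) (Fin.castLE h w) ↔
        w ∈ P.part u := by
  set G := fromEdgeSet (F : Set (Sym2 (Fin n)))
  have hpm : ∀ u, P.part u ∈ P.parts := fun u => P.part_mem.2 (Finset.mem_univ u)
  refine and_congr_right fun _ => ⟨?_, ?_⟩
  · rintro ⟨φ, hφ⟩
    have hφ' : ∀ u, G.connectedComponentMk (Fin.castLE h u) = φ ⟨P.part u, hpm u⟩ :=
      fun u => hφ ⟨P.part u, hpm u⟩ u (mem_part_self' P u)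
    constructor
    · intro v
      obtain ⟨u, hu⟩ := P.nonempty_of_mem_parts (φ.symm (G.connectedComponentMk v)).2
      refine ⟨u, ConnectedComponent.eq.1 ?_⟩
      rw [hφ _ u hu, Equiv.apply_symm_apply]
    · intro u w
      rw [← ConnectedComponent.eq, hφ', hφ', φ.injective.eq_iff, Subtype.mk.injEq,
        Finpartition.mem_part_iff_part_eq_part _ (Finset.mem_univ _) (Finset.mem_univ _), eq_comm]
  · rintro ⟨h1, h2⟩
    choose pt hpt using fun p : {p // p ∈ P.parts} => P.nonempty_of_mem_parts p.2
    have hmem : ∀ p : {p // p ∈ P.parts}, P.part (pt p) = p.1 :=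
      fun p => P.part_eq_of_mem p.2 (hpt p)
    refine ⟨Equiv.ofBijective (fun p => G.connectedComponentMk (Fin.castLE h (pt p))) ⟨?_, ?_⟩, ?_⟩
    · intro p q hpq
      have := (h2 _ _).1 (ConnectedComponent.eq.1 hpq)
      rw [Finpartition.mem_part_iff_part_eq_part _ (Finset.mem_univ _) (Finset.mem_univ _), hmem,
        hmem] at this
      exact Subtype.ext this.symm
    · intro C
      induction C using ConnectedComponent.ind with
      | _ v =>
        obtain ⟨u, hu⟩ := h1 v
        refine ⟨⟨P.part u, hpm u⟩, ConnectedComponent.eq.2 ?_⟩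
        refine Reachable.trans ((h2 _ _).2 ?_) hu.symm
        rw [hmem]
        exact mem_part_self' P u
    · intro p v hv
      refine ConnectedComponent.eq.2 ((h2 _ _).2 ?_)
      rw [P.part_eq_of_mem p.2 hv]
      exact hpt p

theorem mem_compatibleForests_top {h : m ≤ n} {P : MarkedPartition m}
    {F : Finset (Sym2 (Fin n))} :
    F ∈ compatibleForests h ⊤ P ↔ (∀ e ∈ F, ¬ e.IsDiag) ∧ IsCompatibleForest h P F := by
  simp [compatibleForests, Finset.subset_iff, edgeSet_top]

theorem IsCompatibleForest.unique {h : m ≤ n} {P P' : MarkedPartition m}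
    {F : Finset (Sym2 (Fin n))} (hP : IsCompatibleForest h P F) (hP' : IsCompatibleForest h P' F) :
    P = P' :=
  markedPartition_ext fun u v =>
    ((isCompatibleForest_iff.1 hP).2.2 u v).symm.trans ((isCompatibleForest_iff.1 hP').2.2 u v)

/-- Every part of `P` contains exactly one point of `Q`. -/
def IsTransversal (P : MarkedPartition m) (Q : Finset (Fin m)) : Prop :=
  (∀ u, ∃ q ∈ Q, q ∈ P.part u) ∧ ∀ q ∈ Q, ∀ q' ∈ Q, q' ∈ P.part q → q = q'

/-- The partition is reachability restricted to the marked vertices; one root per tree becomes one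
point of `Q` per part. -/
theorem IsRootedForest.exists_isCompatibleForest {h : m ≤ n} {Q : Finset (Fin m)}
    {F : Finset (Sym2 (Fin n))} (hF : IsRootedForest (Q.map (Fin.castLEEmb h)) F) :
    ∃ P, IsCompatibleForest h P F ∧ IsTransversal P Q := by
  classical
  set G := fromEdgeSet (F : Set (Sym2 (Fin n)))
  let s : Setoid (Fin m) := G.reachableSetoid.comap (Fin.castLE h)
  have hpart : ∀ u w, w ∈ (Finpartition.ofSetoid s).part u ↔
      G.Reachable (Fin.castLE h u) (Fin.castLE h w) := fun u w =>
    Finpartition.mem_part_ofSetoid_iff_rel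
  refine ⟨Finpartition.ofSetoid s,
    isCompatibleForest_iff.2 ⟨hF.isAcyclic, fun v => ?_, fun u w => (hpart u w).symm⟩,
    fun u => ?_, fun q hq q' hq' hqq => ?_⟩
  · obtain ⟨q, hq, hvq⟩ := hF.exists_root v
    obtain ⟨u, -, rfl⟩ := Finset.mem_map.1 hq
    exact ⟨u, hvq⟩
  · obtain ⟨q, hq, hvq⟩ := hF.exists_root (Fin.castLE h u)
    obtain ⟨w, hw, rfl⟩ := Finset.mem_map.1 hq
    exact ⟨w, hw, (hpart u w).2 hvq⟩
  · exact (Fin.castLEEmb h).injective (hF.root_unique _ (Finset.mem_map_of_mem _ hq) _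
      (Finset.mem_map_of_mem _ hq') ((hpart q q').1 hqq))

theorem IsCompatibleForest.isRootedForest {h : m ≤ n} {P : MarkedPartition m} {Q : Finset (Fin m)}
    {F : Finset (Sym2 (Fin n))} (hF : IsCompatibleForest h P F) (hdiag : ∀ e ∈ F, ¬ e.IsDiag)
    (hQ : IsTransversal P Q) : IsRootedForest (Q.map (Fin.castLEEmb h)) F := by
  obtain ⟨h1, h2, h3⟩ := isCompatibleForest_iff.1 hF
  refine ⟨hdiag, h1, fun v => ?_, ?_⟩
  · obtain ⟨u, hu⟩ := h2 v
    obtain ⟨q, hq, hqu⟩ := hQ.1 u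
    exact ⟨_, Finset.mem_map_of_mem _ hq, hu.trans ((h3 _ _).2 hqu)⟩
  · intro q hq q' hq' hqq
    obtain ⟨u, hu, rfl⟩ := Finset.mem_map.1 hq
    obtain ⟨w, hw, rfl⟩ := Finset.mem_map.1 hq'
    rw [hQ.2 u hu w hw ((h3 _ _).1 hqq)]

open Classical in
/-- The coefficients of a rooted minor as a combination of set partitions. -/
def rootedCoeff (Q : Finset (Fin m)) (x z : Fin m) (P : MarkedPartition m) : ℤ :=
  if IsTransversal P Q ∧ x ∈ P.part z then 1 else 0

/-- Each forest rooted at `Q` is compatible with exactly one partition, which is transversal to `Q`,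
and whether `z` is joined to `x` depends only on that partition. Exchanging the sums over forests
and partitions therefore gives the expansion. -/
theorem isForestExpansion_rootedMinor (h : m ≤ n) {Q : Finset (Fin m)} {x : Fin m} (hx : x ∈ Q)
    (z : Fin m) :
    IsForestExpansion h (rootedCoeff Q x z)
      (rootedMinor (fun u v => MvPolynomial.X s(u, v)) (Q.map (Fin.castLEEmb h))
        (Fin.castLE h x) (Fin.castLE h z)) := by
  classical
  rw [IsForestExpansion, rootedMinor_eq_sum_forests (fun e => (MvPolynomial.X e))
    (show Fin.castLE h x ∈ Q.map (Fin.castLEEmb h) from Finset.mem_map_of_mem _ hx)]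
  have hR : ∀ P, MvPolynomial.C (rootedCoeff Q x z P) * forestSum h P =
      ∑ F : Finset (Sym2 (Fin n)), if ((∀ e ∈ F, ¬ e.IsDiag) ∧ IsCompatibleForest h P F) ∧
        IsTransversal P Q ∧ x ∈ P.part z then ∏ e ∈ F, MvPolynomial.X e else 0 := by
    intro P
    have hfil : compatibleForests h ⊤ P = Finset.univ.filter
        (fun F => (∀ e ∈ F, ¬ e.IsDiag) ∧ IsCompatibleForest h P F) := by
      ext F
      simp [mem_compatibleForests_top]
    rw [forestSum, hfil, Finset.sum_filter, Finset.mul_sum]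
    refine Finset.sum_congr rfl fun F _ => ?_
    by_cases hc : IsTransversal P Q ∧ x ∈ P.part z
    · simp [rootedCoeff, hc]
    · simp [rootedCoeff, hc]
  rw [Finset.sum_congr rfl fun P _ => hR P, Finset.sum_comm, Finset.sum_filter]
  refine Finset.sum_congr rfl fun F _ => ?_
  by_cases hF : IsRootedForest (Q.map (Fin.castLEEmb h)) F
  · obtain ⟨P, hP, hPQ⟩ := hF.exists_isCompatibleForest
    rw [if_pos hF, Finset.sum_eq_single P]
    · exact if_congr (((isCompatibleForest_iff.1 hP).2.2 z x).trans
        ⟨fun hx => ⟨⟨hF.not_isDiag, hP⟩, hPQ, hx⟩, fun hc => hc.2.2⟩) rfl rfl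
    · rintro P' - hne
      exact if_neg fun hc => hne (hc.1.2.unique hP)
    · simp
  · rw [if_neg hF, Finset.sum_eq_zero]
    intro P _
    exact if_neg fun hc => hF (hc.1.2.isRootedForest hc.1.1 hc.2.1)

theorem exists_isCompatibleForest {k : ℕ} (h : k + 1 ≤ n) (P : MarkedPartition (k + 1)) :
    ∃ F, (∀ e ∈ F, ¬ e.IsDiag) ∧ IsCompatibleForest h P F := by
  classical
  let pick : Finset (Fin (k + 1)) → Fin (k + 1) := fun s => if hs : s.Nonempty then s.min' hs else 0
  have hpick : ∀ u, pick (P.part u) ∈ P.part u := fun u => by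
    have hs : (P.part u).Nonempty := ⟨u, mem_part_self' P u⟩
    simp only [pick, hs, dite_true]
    exact Finset.min'_mem _ _
  have hpart : ∀ u v, v ∈ P.part u → P.part v = P.part u := fun u v huv =>
    (Finpartition.mem_part_iff_part_eq_part _ (Finset.mem_univ _) (Finset.mem_univ _)).1 huv
  -- The witness is a star forest: every marked vertex is sent to the least element of its part, and
  -- every unmarked vertex to the least element of the part of marked vertex 0.
  let toMarked : Fin n → Fin (k + 1) := fun v => if hv : v.val < k + 1 then ⟨v, hv⟩ else 0
  have htoMarked : ∀ u, toMarked (Fin.castLE h u) = u := fun u => dif_pos u.isLt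
  let f : Fin n → Fin n := fun v => Fin.castLE h (pick (P.part (toMarked v)))
  have hff : ∀ v, f (f v) = f v := fun v => by
    simp only [f, htoMarked]
    rw [hpart _ _ (hpick _)]
  have hf : IsRootedMap (Finset.univ.image f) f := by
    refine ⟨fun q hq => ?_, fun v => ⟨1, Finset.mem_image_of_mem f (Finset.mem_univ v)⟩⟩
    obtain ⟨v, -, rfl⟩ := Finset.mem_image.1 hq
    exact hff v
  refine ⟨mapEdges (Finset.univ.image f) f, hf.isRootedForest.not_isDiag,
    isCompatibleForest_iff.2 ⟨hf.isRootedForest.isAcyclic, fun v => ⟨_, hf.reachable_map v⟩, ?_⟩⟩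
  intro u w
  have hfu : ∀ u, f (Fin.castLE h u) = Fin.castLE h (pick (P.part u)) := fun u => by
    simp only [f, htoMarked]
  constructor
  · intro hr
    have hroot := hf.isRootedForest.root_unique _
      (Finset.mem_image_of_mem f (Finset.mem_univ (Fin.castLE h u))) _
      (Finset.mem_image_of_mem f (Finset.mem_univ (Fin.castLE h w)))
      ((hf.reachable_map _).symm.trans (hr.trans (hf.reachable_map _)))
    rw [hfu, hfu] at hroot
    have hroot := (Fin.castLEEmb h).injective hroot
    exact mem_part_trans (hroot ▸ hpick u) (mem_part_comm.1 (hpick w))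
  · intro hw
    refine (hf.reachable_map _).trans (Reachable.trans ?_ (hf.reachable_map _).symm)
    rw [hfu, hfu, hpart u w hw]

theorem prod_X_eq_monomial {σ : Type*} (F : Finset σ) :
    ∏ e ∈ F, (MvPolynomial.X e : MvPolynomial σ ℤ) =
      MvPolynomial.monomial (∑ e ∈ F, Finsupp.single e 1) 1 :=
  (MvPolynomial.monomial_sum_one F _).symm

theorem sum_single_injective {σ : Type*} :
    Function.Injective fun F : Finset σ => ∑ e ∈ F, Finsupp.single e (1 : ℕ) := by
  classical
  intro F F' hF
  have key : ∀ (F : Finset σ) (a : σ),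
      (∑ e ∈ F, Finsupp.single e (1 : ℕ)) a = if a ∈ F then 1 else 0 := fun F a => by
    simp [Finsupp.finsetSum_apply, Finsupp.single_apply]
  ext a
  have := DFunLike.congr_fun hF a
  simp only [key] at this
  by_cases h1 : a ∈ F <;> by_cases h2 : a ∈ F' <;> simp_all

/-- The forest sums are linearly independent: the monomial of a forest compatible with `P` occurs in
the sum for `P`, with coefficient 1, and in no other. This makes the formal combination attached to
a determinant well defined. -/
theorem IsForestExpansion.unique {k : ℕ} {h : k + 1 ≤ n} {α β : MarkedPartition (k + 1) → ℤ}
    {p : MvPolynomial (Sym2 (Fin n)) ℤ} (hα : IsForestExpansion h α p)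
    (hβ : IsForestExpansion h β p) : α = β := by
  classical
  funext P
  obtain ⟨F, hdiag, hF⟩ := exists_isCompatibleForest h P
  have key : ∀ γ : MarkedPartition (k + 1) → ℤ, IsForestExpansion h γ p →
      MvPolynomial.coeff (∑ e ∈ F, Finsupp.single e 1) p = γ P := by
    intro γ hγ
    have hc : ∀ P', MvPolynomial.coeff (∑ e ∈ F, Finsupp.single e 1) (forestSum h P') =
        if P = P' then 1 else 0 := by
      intro P'
      rw [forestSum, MvPolynomial.coeff_sum]
      simp only [prod_X_eq_monomial, MvPolynomial.coeff_monomial, sum_single_injective.eq_iff]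
      rw [Finset.sum_ite_eq']
      refine if_congr ?_ rfl rfl
      rw [mem_compatibleForests_top]
      refine ⟨fun hc => hF.unique hc.2, ?_⟩
      rintro rfl
      exact ⟨hdiag, hF⟩
    rw [hγ, MvPolynomial.coeff_sum]
    simp_rw [MvPolynomial.coeff_C_mul, hc]
    simp
  rw [← key α hα, ← key β hβ]

end Partitions

/-! ### Minors of matrices -/

section Minors

variable {R : Type*} [CommRing R]

/-- The unit rows make the matrix block triangular with an identity block. No sign arises, since
rows and columns are enumerated by the same `p`; in particular `p` need not be increasing. -/
theorem det_submatrix_of_injective {ι V : Type*} [Fintype ι] [DecidableEq ι] [Fintype V]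
    [DecidableEq V] (A : Matrix V V R) {p : ι → V} (hp : Function.Injective p) {S : V → Prop}
    [DecidablePred S] (hS : ∀ v, S v ↔ v ∈ Set.range p) :
    (A.submatrix p p).det =
      (Matrix.of fun v w => if S v then A v w else (Pi.single v 1 : V → R) w).det := by
  let e : ι ≃ {v // S v} :=
    Equiv.ofBijective (fun x => ⟨p x, (hS _).2 ⟨x, rfl⟩⟩)
      ⟨fun x y h => hp (congrArg Subtype.val h), fun ⟨v, hv⟩ => by
        obtain ⟨x, rfl⟩ := (hS v).1 hv
        exact ⟨x, rfl⟩⟩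
  set B : Matrix V V R := Matrix.of fun v w => if S v then A v w else (Pi.single v 1 : V → R) w
    with hB
  have h1 : (B.toSquareBlockProp fun v => ¬ S v) = 1 := by
    ext ⟨v, hv⟩ ⟨w, hw⟩
    simp [Matrix.toSquareBlockProp, hB, hv, Matrix.one_apply, Pi.single_apply, eq_comm]
  have h2 : A.submatrix p p = (B.toSquareBlockProp S).submatrix e e := by
    ext x y
    have hx : S (p x) := (hS _).2 ⟨x, rfl⟩
    exact (if_pos hx).symm
  rw [Matrix.twoBlockTriangular_det B S, h1, Matrix.det_one, mul_one, h2,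
    Matrix.det_submatrix_equiv_self]
  intro v hv w hw
  have : w ≠ v := fun h => hv (h ▸ hw)
  simp [hB, hv, this]

theorem minor_eq {N n : ℕ} (M : Matrix (Fin N) (Fin N) R) {U W : Finset (Fin N)}
    (hU : Uᶜ.card = n) (hW : Wᶜ.card = n) :
    minor M U W = (M.submatrix (Uᶜ.orderEmbOfFin hU) (Wᶜ.orderEmbOfFin hW)).det := by
  subst hU
  rw [minor, dif_pos hW]

theorem det_submatrix_succAbove {N : ℕ} (A : Matrix (Fin (N + 1)) (Fin (N + 1)) R)
    (r c : Fin (N + 1)) :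
    (A.submatrix r.succAbove c.succAbove).det =
      (-1) ^ (r.val + c.val) * (A.updateRow r (Pi.single c 1)).det := by
  rw [← Matrix.adjugate_apply, Matrix.adjugate_fin_succ_eq_det_submatrix, ← mul_assoc, ← mul_pow]
  simp

theorem minor_singleton {N : ℕ} (M : Matrix (Fin N) (Fin N) R) (i j : Fin N) :
    minor M {i} {j} = (-1) ^ (i.val + j.val) * (M.updateRow i (Pi.single j 1)).det := by
  obtain _ | N := N
  · exact i.elim0
  have hcard : ∀ i : Fin (N + 1), ({i} : Finset (Fin (N + 1)))ᶜ.card = N := fun i => by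
    simp [Finset.card_compl]
  have hemb : ∀ i : Fin (N + 1), i.succAbove =
      ({i} : Finset (Fin (N + 1)))ᶜ.orderEmbOfFin (hcard i) := fun i =>
    Finset.orderEmbOfFin_unique (hcard i) (fun x => by simp [Fin.succAbove_ne])
      (Fin.strictMono_succAbove i)
  rw [minor_eq M (hcard i) (hcard j), ← hemb, ← hemb, det_submatrix_succAbove]

theorem mem_initialSeg {k N : ℕ} {v : Fin N} : v ∈ initialSeg k N ↔ v.val < k := by
  simp [initialSeg]

theorem mem_compl_initialSeg_sdiff {k N : ℕ} (h : k ≤ N) (i : Fin k) {v : Fin N} :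
    v ∈ (initialSeg k N \ {Fin.castLE h i})ᶜ ↔ v = Fin.castLE h i ∨ k ≤ v.val := by
  rw [Finset.mem_compl, Finset.mem_sdiff, mem_initialSeg, Finset.mem_singleton]
  by_cases h1 : v = Fin.castLE h i <;> simp [h1]

theorem card_compl_initialSeg_sdiff {k N : ℕ} (h : k ≤ N) (i j : Fin k) :
    (initialSeg k N \ {Fin.castLE h j})ᶜ.card = (initialSeg k N \ {Fin.castLE h i})ᶜ.card := by
  have : ∀ i : Fin k, {Fin.castLE h i} ⊆ initialSeg k N := fun i => by
    simp [mem_initialSeg]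
  simp only [Finset.card_compl, Finset.card_sdiff_of_subset (this _), Finset.card_singleton]

/-- Both `i` and `j` precede all indices `≥ k`, so exchanging them preserves the order of the
indices kept. The second factor is thus a principal minor after one column swap, with no further
sign. -/
theorem orderEmbOfFin_compl_initialSeg_sdiff {k N : ℕ} (h : k ≤ N) (i j : Fin k) :
    (Equiv.swap (Fin.castLE h i) (Fin.castLE h j) ∘
        (initialSeg k N \ {Fin.castLE h i})ᶜ.orderEmbOfFin rfl : _ → Fin N) =
      (initialSeg k N \ {Fin.castLE h j})ᶜ.orderEmbOfFin (card_compl_initialSeg_sdiff h i j) := by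
  have hmem := fun x => (mem_compl_initialSeg_sdiff h i).1 (Finset.orderEmbOfFin_mem
    (initialSeg k N \ {Fin.castLE h i})ᶜ rfl x)
  have hswap : ∀ v : Fin N, k ≤ v.val →
      Equiv.swap (Fin.castLE h i) (Fin.castLE h j) v = v := fun v hv =>
    Equiv.swap_apply_of_ne_of_ne (fun hvi => by subst hvi; exact absurd i.isLt (not_lt.2 hv))
      (fun hvj => by subst hvj; exact absurd j.isLt (not_lt.2 hv))
  refine Finset.orderEmbOfFin_unique _ (fun x => ?_) fun a b hab => ?_
  · rw [mem_compl_initialSeg_sdiff]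
    rcases hmem x with hx | hx
    · simp [hx]
    · simp [hswap _ hx, hx]
  · have hlt := ((initialSeg k N \ {Fin.castLE h i})ᶜ.orderEmbOfFin rfl).strictMono hab
    have hb : k ≤ (((initialSeg k N \ {Fin.castLE h i})ᶜ.orderEmbOfFin rfl) b).val := by
      rcases hmem b with hb | hb
      · rw [hb] at hlt
        rcases hmem a with ha | ha
        · exact absurd (ha ▸ hlt) (lt_irrefl _)
        · have h1 : _ < i.val := hlt
          have := i.isLt
          omega
      · exact hb
    simp only [Function.comp_apply, hswap _ hb]
    rcases hmem a with ha | ha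
    · rw [ha, Equiv.swap_apply_left]
      exact Fin.lt_def.2 (lt_of_lt_of_le j.isLt hb)
    · rwa [hswap _ ha]

theorem secondFactor_eq {k N : ℕ} (M : Matrix (Fin N) (Fin N) R) (h : k ≤ N) (i j : Fin k) :
    secondFactor M h i j =
      (M.submatrix ((initialSeg k N \ {Fin.castLE h i})ᶜ.orderEmbOfFin rfl)
        (Equiv.swap (Fin.castLE h i) (Fin.castLE h j) ∘
          (initialSeg k N \ {Fin.castLE h i})ᶜ.orderEmbOfFin rfl)).det := by
  rw [secondFactor, minor_eq M rfl (card_compl_initialSeg_sdiff h i j),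
    orderEmbOfFin_compl_initialSeg_sdiff]

theorem range_compl_orderEmbOfFin {N n : ℕ} (U : Finset (Fin N)) (hU : Uᶜ.card = n) (v : Fin N) :
    v ∈ Uᶜ ↔ v ∈ Set.range (Uᶜ.orderEmbOfFin hU) := by
  rw [Finset.range_orderEmbOfFin, Finset.mem_coe]

/-- The column expansion identity. -/
theorem det_mul_minor_initialSeg {k N : ℕ} (M : Matrix (Fin N) (Fin N) R) (h : k ≤ N) (j : Fin k) :
    M.det * minor M (initialSeg k N) (initialSeg k N) =
      ∑ i, (-1) ^ (i.val + j.val) * (secondFactor M h i j * firstFactor M h i j) := by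
  let B : Matrix (Fin N) (Fin N) R := Matrix.of fun v => if v.val < k then Pi.single v 1 else M v
  have hB : minor M (initialSeg k N) (initialSeg k N) = B.det := by
    rw [minor_eq M rfl rfl, det_submatrix_of_injective M (RelEmbedding.injective _)
      (range_compl_orderEmbOfFin _ rfl)]
    congr 1
    ext v w
    by_cases hv : v.val < k <;> simp [B, mem_initialSeg, hv]
  have hsecond : ∀ i, secondFactor M h i j = (B.updateRow (Fin.castLE h j)
      (M (Fin.castLE h i))).det := by
    intro i
    set e := (initialSeg k N \ {Fin.castLE h j})ᶜ.orderEmbOfFin (card_compl_initialSeg_sdiff h i j)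
      with he
    have h1 : ((initialSeg k N \ {Fin.castLE h i})ᶜ.orderEmbOfFin rfl : _ → Fin N) =
        Equiv.swap (Fin.castLE h i) (Fin.castLE h j) ∘ e := by
      rw [he, ← orderEmbOfFin_compl_initialSeg_sdiff h i j]
      ext x
      simp
    rw [secondFactor, minor_eq M rfl (card_compl_initialSeg_sdiff h i j), h1, ← he]
    change ((M.submatrix (Equiv.swap (Fin.castLE h i) (Fin.castLE h j)) id).submatrix e e).det = _
    rw [det_submatrix_of_injective _ e.injective (range_compl_orderEmbOfFin _ _)]
    congr 1
    ext v w
    simp only [Matrix.of_apply, mem_compl_initialSeg_sdiff, Matrix.submatrix_apply, id_eq]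
    by_cases hv : v = Fin.castLE h j
    · subst hv
      simp
    · rw [Matrix.updateRow_ne hv]
      by_cases hvk : v.val < k
      · simp [B, hv, hvk]
      · have hvi : v ≠ Fin.castLE h i := fun hvi => hvk (by rw [hvi]; exact i.isLt)
        simp [B, hv, hvk, not_lt.1 hvk, Equiv.swap_apply_of_ne_of_ne hvi hv]
  -- `y` is column `j` of the adjugate of `B`, so `g ⬝ᵥ y` is `det B` with row `j` replaced by `g`.
  -- Entry `i` of `M y` is therefore the second factor for `i < k`, and 0 below, where a row is
  -- repeated. Component `j` of `adj(M) (M y) = det(M) y` is the identity.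
  let y : Fin N → R := fun t => B.adjugate t (Fin.castLE h j)
  have hrow : ∀ g : Fin N → R, (B.updateRow (Fin.castLE h j) g).det = g ⬝ᵥ y := by
    intro g
    rw [← Matrix.det_transpose, ← Matrix.updateCol_transpose, ← Matrix.cramer_apply,
      Matrix.cramer_eq_adjugate_mulVec, ← Matrix.adjugate_transpose]
    simp [Matrix.mulVec, dotProduct, y, mul_comm]
  have hMy : ∀ v : Fin N, k ≤ v.val → M.mulVec y v = 0 := by
    intro v hv
    have hne : v ≠ Fin.castLE h j := fun hvj => by
      subst hvj
      exact absurd j.isLt (not_lt.2 hv)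
    have : B v = M v := by
      ext w
      simp [B, not_lt.2 hv]
    rw [Matrix.mulVec, ← hrow, ← this]
    exact Matrix.det_updateRow_eq_zero hne
  have hy : y (Fin.castLE h j) = B.det := by
    change B.adjugate _ _ = _
    rw [Matrix.adjugate_apply]
    congr 1
    have : (Pi.single (Fin.castLE h j) 1 : Fin N → R) = B (Fin.castLE h j) := by
      ext w
      simp [B]
    rw [this, Matrix.updateRow_eq_self]
  have hcr : (M.cramer (M.mulVec y)) (Fin.castLE h j) = M.det * B.det := by
    rw [Matrix.cramer_eq_adjugate_mulVec, Matrix.mulVec_mulVec, Matrix.adjugate_mul,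
      Matrix.smul_mulVec, Matrix.one_mulVec, Pi.smul_apply, hy, smul_eq_mul]
  rw [hB, ← hcr, Matrix.cramer_eq_adjugate_mulVec]
  have hsplit : ∀ g : Fin N → R, (∀ v : Fin N, k ≤ v.val → g v = 0) →
      ∑ v, g v = ∑ i : Fin k, g (Fin.castLE h i) := by
    intro g hg
    rw [show ∑ i : Fin k, g (Fin.castLE h i) = _ from
      (Finset.sum_map Finset.univ (Fin.castLEEmb h) g).symm]
    symm
    refine Finset.sum_subset (Finset.subset_univ _) fun v _ hv => hg v ?_
    by_contra hlt
    exact hv (Finset.mem_map.2 ⟨⟨v.val, not_le.1 hlt⟩, Finset.mem_univ _, rfl⟩)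
  rw [Matrix.mulVec, dotProduct, hsplit _ (fun v hv => by rw [hMy v hv, mul_zero])]
  refine Finset.sum_congr rfl fun i _ => ?_
  rw [hsecond, hrow, firstFactor, minor_singleton, Matrix.adjugate_apply]
  have hsign : ((-1 : R) ^ (i.val + j.val)) * (-1) ^ (i.val + j.val) = 1 := by
    rw [← mul_pow]; simp
  simp only [Fin.val_castLE]
  rw [Matrix.mulVec]
  linear_combination (-(M (Fin.castLE h i) ⬝ᵥ y) *
    (M.updateRow (Fin.castLE h i) (Pi.single (Fin.castLE h j) 1)).det) * hsign

end Minors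

/-! ### Forest expansions of the minors of the Laplacian -/

section LaplacianMinors

variable {k N : ℕ}

theorem IsForestExpansion.C_mul {m n : ℕ} {h : m ≤ n} {α : MarkedPartition m → ℤ}
    {p : MvPolynomial (Sym2 (Fin n)) ℤ} (hα : IsForestExpansion h α p) (e : ℤ) :
    IsForestExpansion h (fun P => e * α P) (MvPolynomial.C e * p) := by
  rw [IsForestExpansion, hα, Finset.mul_sum]
  refine Finset.sum_congr rfl fun P _ => ?_
  rw [MvPolynomial.C_mul, mul_assoc]

theorem IsForestExpansion.sub {m n : ℕ} {h : m ≤ n} {α β : MarkedPartition m → ℤ}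
    {p q : MvPolynomial (Sym2 (Fin n)) ℤ} (hα : IsForestExpansion h α p)
    (hβ : IsForestExpansion h β q) : IsForestExpansion h (fun P => α P - β P) (p - q) := by
  rw [IsForestExpansion, hα, hβ, ← Finset.sum_sub_distrib]
  refine Finset.sum_congr rfl fun P _ => ?_
  rw [MvPolynomial.C_sub, sub_mul]

/-- The rooted minors of the Laplacian of the complete graph, indexed by marked vertices. -/
def markedMinor (h : k ≤ N) (Q : Finset (Fin (k + 1))) (x z : Fin (k + 1)) :
    MvPolynomial (Sym2 (Fin (N + 1))) ℤ :=
  rootedMinor (fun u v => MvPolynomial.X s(u, v)) (Q.map (Fin.castLEEmb (Nat.succ_le_succ h)))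
    (Fin.castLE (Nat.succ_le_succ h) x) (Fin.castLE (Nat.succ_le_succ h) z)

theorem isForestExpansion_markedMinor (h : k ≤ N) {Q : Finset (Fin (k + 1))} {x : Fin (k + 1)}
    (hx : x ∈ Q) (z : Fin (k + 1)) :
    IsForestExpansion (Nat.succ_le_succ h) (rootedCoeff Q x z) (markedMinor h Q x z) :=
  isForestExpansion_rootedMinor _ hx z

theorem castLE_succAbove (h : k ≤ N) (r : Fin (k + 1)) (i : Fin k) :
    (Fin.castLE (Nat.succ_le_succ h) r).succAbove (Fin.castLE h i) =
      Fin.castLE (Nat.succ_le_succ h) (r.succAbove i) := by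
  ext
  simp only [Fin.succAbove, Fin.lt_def, Fin.val_castSucc, Fin.val_castLE]
  split_ifs <;> simp

theorem val_succAbove_castLE_of_le (h : k ≤ N) (r : Fin (k + 1)) {v : Fin N} (hv : k ≤ v.val) :
    ((Fin.castLE (Nat.succ_le_succ h) r).succAbove v).val = v.val + 1 := by
  have := r.isLt
  rw [Fin.succAbove_of_le_castSucc _ _ (Fin.le_def.2 (by simp; omega))]
  simp

theorem succAbove_castLE_of_le (h : k ≤ N) (r c : Fin (k + 1)) {v : Fin N} (hv : k ≤ v.val) :
    (Fin.castLE (Nat.succ_le_succ h) r).succAbove v =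
      (Fin.castLE (Nat.succ_le_succ h) c).succAbove v :=
  Fin.ext ((val_succAbove_castLE_of_le h r hv).trans (val_succAbove_castLE_of_le h c hv).symm)

theorem exists_succAbove_of_le (h : k ≤ N) (r : Fin (k + 1)) {w : Fin (N + 1)}
    (hw : k + 1 ≤ w.val) :
    ∃ v : Fin N, k ≤ v.val ∧ (Fin.castLE (Nat.succ_le_succ h) r).succAbove v = w := by
  have := w.isLt
  refine ⟨⟨w.val - 1, by omega⟩, by simp; omega, Fin.ext ?_⟩
  rw [val_succAbove_castLE_of_le h r (by simp; omega)]
  simp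
  omega

theorem det_reducedLaplacian (h : k ≤ N) (r c : Fin (k + 1)) :
    (reducedLaplacian h r c).det =
      MvPolynomial.C ((-1) ^ (r.val + c.val)) * markedMinor h {r} r c := by
  rw [reducedLaplacian, det_submatrix_succAbove]
  congr 1
  · simp
  · rw [markedMinor, rootedMinor]
    congr 1
    ext1 v w
    by_cases hv : v = Fin.castLE (Nat.succ_le_succ h) r
    · subst hv
      simp
    · simp [hv, completeLaplacian]

/-- Since the rows of the Laplacian sum to zero, its minors with two removed rows and columns are
differences of rooted minors. -/
theorem det_updateRow_updateRow_laplacian {V R : Type*} [Fintype V] [DecidableEq V] [CommRing R]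
    [IsDomain R] (a : V → V → R) {x y : V} (hxy : x ≠ y) (z w : V) :
    (((laplacian a).updateRow y (Pi.single w 1)).updateRow x (Pi.single z 1)).det =
      rootedMinor a {x, y} x z - rootedMinor a {x, y} x w := by
  have hD : ∀ t, rootedMinor a {x, y} x t =
      (((laplacian a).updateRow y (Pi.single y 1)).updateRow x (Pi.single t 1)).det := by
    intro t
    rw [rootedMinor]
    congr 1
    ext1 v u
    by_cases hvx : v = x
    · subst hvx
      simp
    · by_cases hvy : v = y
      · subst hvy
        simp [hvx]
      · simp [hvx, hvy]
  -- All rows of this matrix sum to zero, so it kills the all-ones vector. Expanding the two altered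
  -- rows gives four determinants; the one with `e_w` twice vanishes and the others give the claim.
  have h0 : (((laplacian a).updateRow y (Pi.single w 1 - Pi.single y 1)).updateRow x
      (Pi.single z 1 - Pi.single w 1)).det = 0 := by
    have : Nonempty V := ⟨x⟩
    refine Matrix.exists_mulVec_eq_zero_iff.1 ⟨fun _ => 1, fun h => one_ne_zero (congrFun h x), ?_⟩
    ext v
    change _ ⬝ᵥ _ = (0 : R)
    by_cases hvx : v = x
    · subst hvx
      rw [Matrix.updateRow_self, sub_dotProduct, single_dotProduct, single_dotProduct, sub_self]
    · rw [Matrix.updateRow_ne hvx]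
      by_cases hvy : v = y
      · subst hvy
        rw [Matrix.updateRow_self, sub_dotProduct, single_dotProduct, single_dotProduct, sub_self]
      · rw [Matrix.updateRow_ne hvy, laplacian_row, sum_dotProduct]
        refine Finset.sum_eq_zero fun t _ => ?_
        rw [smul_dotProduct, sub_dotProduct, single_dotProduct, single_dotProduct, sub_self,
          smul_zero]
  have hx : ∀ (M : Matrix V V R) (i : V) (u v : V → R),
      (M.updateRow i (u - v)).det = (M.updateRow i u).det - (M.updateRow i v).det := fun M i u v =>
    (Matrix.detRowAlternating : (V → R) [⋀^V]→ₗ[R] R).map_update_sub M i u v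
  have hdup : (((laplacian a).updateRow x (Pi.single w 1)).updateRow y (Pi.single w 1)).det = 0 :=
    Matrix.det_zero_of_row_eq hxy (by ext; simp [hxy])
  rw [hD, hD]
  rw [hx] at h0
  simp only [Matrix.updateRow_comm _ hxy.symm] at h0 ⊢
  rw [hx, hx, hdup] at h0
  linear_combination h0

/-- The determinant omits rows `r`, `r.succAbove i` and columns `c`, `c.succAbove j` of the
Laplacian, so the difference formula applies; each of the two deletions contributes its own sign. -/
theorem firstFactor_reducedLaplacian (h : k ≤ N) (r c : Fin (k + 1)) (i j : Fin k) :
    firstFactor (reducedLaplacian h r c) h i j =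
      MvPolynomial.C ((-1) ^ (i.val + j.val + (r.val + c.val))) *
        (markedMinor h {r, r.succAbove i} r c -
          markedMinor h {r, r.succAbove i} r (c.succAbove j)) := by
  have hM : (reducedLaplacian h r c).updateRow (Fin.castLE h i) (Pi.single (Fin.castLE h j) 1) =
      ((completeLaplacian (N + 1)).updateRow (Fin.castLE (Nat.succ_le_succ h) (r.succAbove i))
        (Pi.single (Fin.castLE (Nat.succ_le_succ h) (c.succAbove j)) 1)).submatrix
        (Fin.castLE (Nat.succ_le_succ h) r).succAbove
        (Fin.castLE (Nat.succ_le_succ h) c).succAbove := by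
    ext1 v w
    rw [← castLE_succAbove h, ← castLE_succAbove h]
    by_cases hv : v = Fin.castLE h i
    · subst hv
      simp [Pi.single_apply, Fin.succAbove_right_injective.eq_iff]
    · have hv' : (Fin.castLE (Nat.succ_le_succ h) r).succAbove v ≠
          (Fin.castLE (Nat.succ_le_succ h) r).succAbove (Fin.castLE h i) :=
        fun he => hv (Fin.succAbove_right_injective he)
      rw [Matrix.updateRow_ne hv, Matrix.submatrix_apply, Matrix.updateRow_ne hv']
      rfl
  have hne : Fin.castLE (Nat.succ_le_succ h) r ≠
      Fin.castLE (Nat.succ_le_succ h) (r.succAbove i) := fun he =>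
    Fin.succAbove_ne r i ((Fin.castLEEmb (Nat.succ_le_succ h)).injective he).symm
  rw [firstFactor, minor_singleton, hM, det_submatrix_succAbove, completeLaplacian,
    det_updateRow_updateRow_laplacian _ hne]
  simp only [markedMinor, Finset.map_insert, Finset.map_singleton, Fin.val_castLE, pow_add,
    MvPolynomial.C_mul, map_pow, map_neg, map_one, Fin.castLEEmb_apply]
  ring

/-- Exactly the unmarked rows and columns are left, whatever `r` and `c` are. With all marked
vertices as roots, taking `x = z = 0` changes nothing. -/
theorem minor_initialSeg_reducedLaplacian (h : k ≤ N) (r c : Fin (k + 1)) :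
    minor (reducedLaplacian h r c) (initialSeg k N) (initialSeg k N) =
      markedMinor h Finset.univ 0 0 := by
  set e := (initialSeg k N)ᶜ.orderEmbOfFin rfl with he
  have hmem : ∀ x, k ≤ (e x).val := fun x => by
    have := Finset.orderEmbOfFin_mem (initialSeg k N)ᶜ rfl x
    rw [Finset.mem_compl, mem_initialSeg] at this
    exact not_lt.1 this
  have h1 : (reducedLaplacian h r c).submatrix e e = (completeLaplacian (N + 1)).submatrix
      ((Fin.castLE (Nat.succ_le_succ h) r).succAbove ∘ e)
      ((Fin.castLE (Nat.succ_le_succ h) r).succAbove ∘ e) := by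
    ext1 x y
    simp only [reducedLaplacian, Matrix.submatrix_apply, Function.comp_apply,
      succAbove_castLE_of_le h c r (hmem y)]
  rw [minor_eq _ rfl rfl, ← he, h1, det_submatrix_of_injective _
    (Fin.succAbove_right_injective.comp e.injective) (S := fun v => k + 1 ≤ v.val)]
  · rw [markedMinor, rootedMinor]
    congr 1
    ext1 v w
    by_cases hv : v = Fin.castLE (Nat.succ_le_succ h) 0
    · subst hv
      simp
    · rw [Matrix.updateRow_ne hv]
      have hmap : v ∈ Finset.univ.map (Fin.castLEEmb (Nat.succ_le_succ h)) ↔ ¬ k + 1 ≤ v.val := by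
        rw [Finset.mem_map]
        constructor
        · rintro ⟨u, -, rfl⟩
          exact not_le.2 u.isLt
        · exact fun hlt => ⟨⟨v.val, not_le.1 hlt⟩, Finset.mem_univ _, rfl⟩
      by_cases hvk : k + 1 ≤ v.val
      · have : v ∉ Finset.univ.map (Fin.castLEEmb (Nat.succ_le_succ h)) :=
          fun hc => hmap.1 hc hvk
        rw [Matrix.of_apply, Matrix.of_apply, if_pos hvk, if_neg this]
        rfl
      · rw [Matrix.of_apply, Matrix.of_apply, if_neg hvk, if_pos (hmap.2 hvk)]
  · intro v
    constructor
    · intro hv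
      obtain ⟨w, hw, rfl⟩ := exists_succAbove_of_le h r hv
      have : w ∈ Set.range e := by
        rw [he, Finset.range_orderEmbOfFin, Finset.mem_coe, Finset.mem_compl, mem_initialSeg]
        exact not_lt.2 hw
      obtain ⟨x, rfl⟩ := this
      exact ⟨x, rfl⟩
    · rintro ⟨x, rfl⟩
      rw [Function.comp_apply, val_succAbove_castLE_of_le h r (hmem x)]
      exact Nat.succ_le_succ (hmem x)

/-- The rows left are `r.succAbove i` and the unmarked ones, the columns left `c.succAbove j` and
the unmarked ones. A transposition of columns makes the two index sets agree. -/
theorem secondFactor_reducedLaplacian_eq_det (h : k ≤ N) (r c : Fin (k + 1)) (i j : Fin k) :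
    secondFactor (reducedLaplacian h r c) h i j =
      (Matrix.of fun v w => if v = Fin.castLE (Nat.succ_le_succ h) (r.succAbove i) ∨ k + 1 ≤ v.val
        then completeLaplacian (N + 1) v
          (Equiv.swap (Fin.castLE (Nat.succ_le_succ h) (r.succAbove i))
            (Fin.castLE (Nat.succ_le_succ h) (c.succAbove j)) w)
        else (Pi.single v 1 : _ → MvPolynomial (Sym2 (Fin (N + 1))) ℤ) w).det := by
  rw [secondFactor_eq]
  set e := (initialSeg k N \ {Fin.castLE h i})ᶜ.orderEmbOfFin rfl with he
  set τ := Equiv.swap (Fin.castLE (Nat.succ_le_succ h) (r.succAbove i))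
    (Fin.castLE (Nat.succ_le_succ h) (c.succAbove j)) with hτ
  have hmem : ∀ x, e x = Fin.castLE h i ∨ k ≤ (e x).val := fun x =>
    (mem_compl_initialSeg_sdiff h i).1 (Finset.orderEmbOfFin_mem _ rfl x)
  have hne : ∀ {n : ℕ} (u : Fin n) (hn : n ≤ N) (v : Fin N), n ≤ v.val → v ≠ Fin.castLE hn u :=
    fun u hn v hv hvu => by
      subst hvu
      exact absurd u.isLt (not_lt.2 hv)
  have hne' : ∀ (u : Fin (k + 1)) (v : Fin (N + 1)), k + 1 ≤ v.val →
      v ≠ Fin.castLE (Nat.succ_le_succ h) u := fun u v hv hvu => by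
    subst hvu
    exact absurd u.isLt (not_lt.2 hv)
  have h1 : (reducedLaplacian h r c).submatrix e
      (Equiv.swap (Fin.castLE h i) (Fin.castLE h j) ∘ e) =
        ((completeLaplacian (N + 1)).submatrix id τ).submatrix
          ((Fin.castLE (Nat.succ_le_succ h) r).succAbove ∘ e)
          ((Fin.castLE (Nat.succ_le_succ h) r).succAbove ∘ e) := by
    ext1 x y
    simp only [reducedLaplacian, Matrix.submatrix_apply, Function.comp_apply, id_eq]
    congr 1
    rcases hmem y with hy | hy
    · rw [hy, Equiv.swap_apply_left, castLE_succAbove, castLE_succAbove, hτ,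
        Equiv.swap_apply_left]
    · have hv := val_succAbove_castLE_of_le h r hy
      rw [Equiv.swap_apply_of_ne_of_ne (hne i h _ hy) (hne j h _ hy), hτ,
        Equiv.swap_apply_of_ne_of_ne (hne' _ _ (hv ▸ Nat.succ_le_succ hy))
          (hne' _ _ (hv ▸ Nat.succ_le_succ hy)), succAbove_castLE_of_le h c r hy]
  rw [h1, det_submatrix_of_injective _ (Fin.succAbove_right_injective.comp e.injective)
    (S := fun v => v = Fin.castLE (Nat.succ_le_succ h) (r.succAbove i) ∨ k + 1 ≤ v.val)]
  · rfl
  · have hrange : ∀ w : Fin N, w = Fin.castLE h i ∨ k ≤ w.val → w ∈ Set.range e := fun w hw => by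
      rw [he, Finset.range_orderEmbOfFin, Finset.mem_coe]
      exact (mem_compl_initialSeg_sdiff h i).2 hw
    intro v
    constructor
    · rintro (rfl | hv)
      · obtain ⟨x, hx⟩ := hrange _ (Or.inl rfl)
        exact ⟨x, by rw [Function.comp_apply, hx, castLE_succAbove]⟩
      · obtain ⟨w, hw, rfl⟩ := exists_succAbove_of_le h r hv
        obtain ⟨x, rfl⟩ := hrange w (Or.inr hw)
        exact ⟨x, rfl⟩
    · rintro ⟨x, rfl⟩
      rw [Function.comp_apply]
      rcases hmem x with hx | hx
      · left
        rw [hx, castLE_succAbove]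
      · right
        rw [val_succAbove_castLE_of_le h r hx]
        exact Nat.succ_le_succ hx

theorem mem_map_univ_erase (h : k ≤ N) (u : Fin (k + 1)) (v : Fin (N + 1)) :
    v ∈ (Finset.univ.erase u).map (Fin.castLEEmb (Nat.succ_le_succ h)) ↔
      ¬ (v = Fin.castLE (Nat.succ_le_succ h) u ∨ k + 1 ≤ v.val) := by
  rw [Finset.mem_map]
  constructor
  · rintro ⟨w, hw, rfl⟩ (hwu | hwk)
    · exact Finset.ne_of_mem_erase hw ((Fin.castLEEmb (Nat.succ_le_succ h)).injective hwu)
    · exact absurd w.isLt (not_lt.2 hwk)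
  · intro hv
    rw [not_or] at hv
    refine ⟨⟨v.val, not_le.1 hv.2⟩, Finset.mem_erase.2 ⟨fun he => hv.1 ?_, Finset.mem_univ _⟩, rfl⟩
    rw [← he]
    rfl

theorem secondFactor_reducedLaplacian_of_eq (h : k ≤ N) {r c : Fin (k + 1)} {i j : Fin k}
    (hij : r.succAbove i = c.succAbove j) :
    secondFactor (reducedLaplacian h r c) h i j =
      markedMinor h (Finset.univ.erase (c.succAbove j)) c c := by
  rw [secondFactor_reducedLaplacian_eq_det, hij, Equiv.swap_self, markedMinor, rootedMinor]
  congr 1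
  ext1 v w
  by_cases hv : v = Fin.castLE (Nat.succ_le_succ h) c
  · subst hv
    have : ¬ (Fin.castLE (Nat.succ_le_succ h) c = Fin.castLE (Nat.succ_le_succ h) (c.succAbove j) ∨
        k + 1 ≤ (Fin.castLE (Nat.succ_le_succ h) c).val) :=
      (mem_map_univ_erase h _ _).1 (Finset.mem_map_of_mem _
        (Finset.mem_erase.2 ⟨(Fin.succAbove_ne c j).symm, Finset.mem_univ _⟩))
    rw [Matrix.of_apply, if_neg this, Matrix.updateRow_self]
  · rw [Matrix.updateRow_ne hv, Matrix.of_apply, Matrix.of_apply]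
    by_cases hc : v = Fin.castLE (Nat.succ_le_succ h) (c.succAbove j) ∨ k + 1 ≤ v.val
    · rw [if_pos hc, if_neg (fun hm => (mem_map_univ_erase h _ _).1 hm hc)]
      rfl
    · rw [if_neg hc, if_pos ((mem_map_univ_erase h _ _).2 hc)]

/-- Undoing the column transposition costs the sign, and turns the unit row of `c.succAbove j` into
the unit vector at `r.succAbove i`. -/
theorem secondFactor_reducedLaplacian_of_ne (h : k ≤ N) {r c : Fin (k + 1)} {i j : Fin k}
    (hij : r.succAbove i ≠ c.succAbove j) :
    secondFactor (reducedLaplacian h r c) h i j =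
      - markedMinor h (Finset.univ.erase (r.succAbove i)) (c.succAbove j) (r.succAbove i) := by
  set u := r.succAbove i
  set w := c.succAbove j
  have hne : Fin.castLE (Nat.succ_le_succ h) u ≠ Fin.castLE (Nat.succ_le_succ h) w :=
    fun he => hij ((Fin.castLEEmb (Nat.succ_le_succ h)).injective he)
  have hsign := Matrix.det_permute' (Equiv.swap (Fin.castLE (Nat.succ_le_succ h) u)
    (Fin.castLE (Nat.succ_le_succ h) w))
    ((Matrix.of fun v => if v ∈ (Finset.univ.erase u).map (Fin.castLEEmb (Nat.succ_le_succ h))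
      then Pi.single v 1 else completeLaplacian (N + 1) v).updateRow
        (Fin.castLE (Nat.succ_le_succ h) w) (Pi.single (Fin.castLE (Nat.succ_le_succ h) u) 1))
  rw [Equiv.Perm.sign_swap hne] at hsign
  rw [secondFactor_reducedLaplacian_eq_det, markedMinor, rootedMinor]
  refine Eq.trans ?_ (hsign.trans (by simp [completeLaplacian]))
  congr 1
  ext1 v t
  rw [Matrix.of_apply, Matrix.submatrix_apply, id_eq]
  by_cases hv : v = Fin.castLE (Nat.succ_le_succ h) w
  · subst hv
    have : ¬ (Fin.castLE (Nat.succ_le_succ h) w = Fin.castLE (Nat.succ_le_succ h) u ∨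
        k + 1 ≤ (Fin.castLE (Nat.succ_le_succ h) w).val) :=
      (mem_map_univ_erase h _ _).1 (Finset.mem_map_of_mem _
        (Finset.mem_erase.2 ⟨hij.symm, Finset.mem_univ _⟩))
    rw [if_neg this, Matrix.updateRow_self, Pi.single_apply, Pi.single_apply]
    refine if_congr ?_ rfl rfl
    rw [Equiv.swap_apply_eq_iff, Equiv.swap_apply_left]
  · rw [Matrix.updateRow_ne hv, Matrix.of_apply]
    by_cases hc : v = Fin.castLE (Nat.succ_le_succ h) u ∨ k + 1 ≤ v.val
    · rw [if_pos hc, if_neg (fun hm => (mem_map_univ_erase h _ _).1 hm hc)]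
    · rw [if_neg hc, if_pos ((mem_map_univ_erase h _ _).2 hc), Pi.single_apply, Pi.single_apply]
      refine if_congr ?_ rfl rfl
      rw [Equiv.swap_apply_eq_iff, Equiv.swap_apply_of_ne_of_ne (fun he => hc (Or.inl he)) hv]

end LaplacianMinors

/-! ### The coefficients of the two sides -/

section Coefficients

variable {m k N : ℕ}

theorem IsTransversal.card_parts {P : MarkedPartition m} {Q : Finset (Fin m)}
    (h : IsTransversal P Q) : P.parts.card = Q.card := by
  symm
  refine Finset.card_bij (fun q _ => P.part q) (fun q _ => P.part_mem.2 (Finset.mem_univ q)) ?_ ?_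
  · intro q hq q' hq' hqq
    exact h.2 q hq q' hq' (hqq ▸ mem_part_self' P q')
  · intro p hp
    obtain ⟨u, hu⟩ := P.nonempty_of_mem_parts hp
    obtain ⟨q, hq, hqu⟩ := h.1 u
    exact ⟨q, hq, P.part_eq_of_mem hp (by rwa [P.part_eq_of_mem hp hu] at hqu)⟩

theorem part_eq_part_of_mem {P : MarkedPartition m} {u v : Fin m} (h : v ∈ P.part u) :
    P.part v = P.part u :=
  (Finpartition.mem_part_iff_part_eq_part _ (Finset.mem_univ _) (Finset.mem_univ _)).1 h

/-- `{j, l}` is a part of `P`, and the other parts are singletons. -/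
def IsPairPartition (P : MarkedPartition m) (j l : Fin m) : Prop :=
  {j, l} ∈ P.parts ∧ ∀ v, v ≠ j → v ≠ l → {v} ∈ P.parts

theorem IsPairPartition.symm {P : MarkedPartition m} {j l : Fin m} (h : IsPairPartition P j l) :
    IsPairPartition P l j :=
  ⟨Finset.pair_comm j l ▸ h.1, fun v hl hj => h.2 v hj hl⟩

/-- With every marked vertex but `j` alone among the roots of its part, the only freedom is which
root `j` joins. This is the shape of the partitions in a second factor. -/
theorem isPairPartition_iff {P : MarkedPartition m} {j l : Fin m} (hlj : l ≠ j) :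
    IsPairPartition P j l ↔ IsTransversal P (Finset.univ.erase j) ∧ l ∈ P.part j := by
  constructor
  · rintro ⟨hp, hs⟩
    have hj : P.part j = {j, l} := P.part_eq_of_mem hp (by simp)
    have hl : P.part l = {j, l} := P.part_eq_of_mem hp (by simp)
    have hv : ∀ v, v ≠ j → v ≠ l → P.part v = {v} := fun v h1 h2 =>
      P.part_eq_of_mem (hs v h1 h2) (by simp)
    refine ⟨⟨fun u => ?_, fun q hq q' hq' hqq => ?_⟩, by simp [hj]⟩
    · by_cases hu : u = j
      · exact ⟨l, by simp [hlj], by simp [hu, hj]⟩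
      · exact ⟨u, by simp [hu], mem_part_self' P u⟩
    · have h1 := Finset.ne_of_mem_erase hq
      have h2 := Finset.ne_of_mem_erase hq'
      by_cases hql : q = l
      · rw [hql, hl] at hqq
        rw [hql]
        rcases Finset.mem_insert.1 hqq with h | h
        · exact absurd h h2
        · exact (Finset.mem_singleton.1 h).symm
      · rw [hv q h1 hql] at hqq
        exact (Finset.mem_singleton.1 hqq).symm
  · rintro ⟨⟨_, hu⟩, hl⟩
    have hmem : ∀ v, v ≠ j → ∀ w, w ≠ j → w ∈ P.part v → v = w := fun v hv w hw =>
      hu v (by simp [hv]) w (by simp [hw])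
    constructor
    · have : P.part j = {j, l} := by
        ext w
        rw [Finset.mem_insert, Finset.mem_singleton]
        constructor
        · intro hw
          by_cases hwj : w = j
          · exact Or.inl hwj
          · exact Or.inr (hmem l hlj w hwj (by rwa [part_eq_part_of_mem hl])).symm
        · rintro (rfl | rfl)
          · exact mem_part_self' P _
          · exact hl
      rw [← this]
      exact P.part_mem.2 (Finset.mem_univ _)
    · intro v hvj hvl
      have : P.part v = {v} := by
        ext w
        rw [Finset.mem_singleton]
        constructor
        · intro hw
          by_cases hwj : w = j
          · subst hwj
            refine absurd (hmem v hvj l hlj ?_) hvl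
            rwa [← part_eq_part_of_mem hw]
          · exact (hmem v hvj w hwj hw).symm
        · rintro rfl
          exact mem_part_self' P _
      rw [← this]
      exact P.part_mem.2 (Finset.mem_univ _)

theorem IsPairPartition.unique {P : MarkedPartition m} {j l l' : Fin m} (hl : l ≠ j)
    (h : IsPairPartition P j l) (h' : IsPairPartition P j l') : l = l' := by
  have h1 : P.part j = {j, l} := P.part_eq_of_mem h.1 (by simp)
  have h2 : P.part j = {j, l'} := P.part_eq_of_mem h'.1 (by simp)
  have : l ∈ ({j, l'} : Finset (Fin m)) := by rw [← h2, h1]; simp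
  simpa [hl] using this

theorem exists_isPairPartition {P : MarkedPartition m} {j : Fin m}
    (h : IsTransversal P (Finset.univ.erase j)) : ∃ l, l ≠ j ∧ IsPairPartition P j l := by
  obtain ⟨l, hl, hlj⟩ := h.1 j
  have hne := Finset.ne_of_mem_erase hl
  exact ⟨l, hne, (isPairPartition_iff hne).2 ⟨h, hlj⟩⟩

theorem IsPairPartition.card_parts {P : MarkedPartition m} {j l : Fin m} (hl : l ≠ j)
    (h : IsPairPartition P j l) : P.parts.card + 1 = m := by
  rw [((isPairPartition_iff hl).1 h).1.card_parts, Finset.card_erase_of_mem (Finset.mem_univ j),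
    Finset.card_univ, Fintype.card_fin]
  have := j.isLt
  omega

/-- A partition into two parts is a 2-colouring, encoded by membership in the part of the fixed
vertex `r`; all conditions on `B` become Boolean in this colour. -/
theorem mem_part_iff_of_card_eq_two {P : MarkedPartition m} (hP : P.parts.card = 2)
    (r u v : Fin m) : v ∈ P.part u ↔ (u ∈ P.part r ↔ v ∈ P.part r) := by
  constructor
  · intro h
    exact ⟨fun hu => mem_part_trans hu h, fun hv => mem_part_trans hv (mem_part_comm.1 h)⟩
  · intro h
    by_cases hu : u ∈ P.part r
    · exact mem_part_trans (mem_part_comm.1 hu) (h.1 hu)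
    · have hv : v ∉ P.part r := fun hv => hu (h.2 hv)
      obtain ⟨p, q, -, hpq⟩ := Finset.card_eq_two.1 hP
      have hmem : ∀ w, P.part w = p ∨ P.part w = q := fun w => by
        have : P.part w ∈ P.parts := P.part_mem.2 (Finset.mem_univ w)
        simpa [hpq] using this
      have hne : ∀ w, w ∉ P.part r → P.part w ≠ P.part r := fun w hw he =>
        hw (he ▸ mem_part_self' P w)
      have hru := hne u hu
      have hrv := hne v hv
      have : P.part v = P.part u := by
        rcases hmem r with h1 | h1 <;> rcases hmem u with h2 | h2 <;>
          rcases hmem v with h3 | h3 <;> simp_all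
      rw [← this]
      exact mem_part_self' P v

theorem isTransversal_pair_iff {P : MarkedPartition m} {r u : Fin m} (hru : r ≠ u) :
    IsTransversal P {r, u} ↔ P.parts.card = 2 ∧ u ∉ P.part r := by
  constructor
  · intro h
    exact ⟨by rw [h.card_parts, Finset.card_pair hru], fun hu => hru (h.2 r (by simp) u (by simp) hu)⟩
  · rintro ⟨hP, hu⟩
    refine ⟨fun w => ?_, ?_⟩
    · by_cases hw : r ∈ P.part w
      · exact ⟨r, by simp, hw⟩
      · refine ⟨u, by simp, (mem_part_iff_of_card_eq_two hP r w u).2 ?_⟩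
        rw [mem_part_comm] at hw
        exact iff_of_false hw hu
    · intro q hq q' hq' hqq
      rw [Finset.mem_insert, Finset.mem_singleton] at hq hq'
      rcases hq with rfl | rfl <;> rcases hq' with rfl | rfl
      · rfl
      · exact absurd hqq hu
      · exact absurd (mem_part_comm.1 hqq) hu
      · rfl

theorem isPermissible_iff {A B : MarkedPartition m} {c j l : Fin m} (hl : l ≠ j)
    (hA : IsPairPartition A j l) :
    IsPermissible c j (A, B) ↔ B.parts.card = 2 ∧ l ∈ B.part c ∧ j ∉ B.part c := by
  constructor
  · rintro ⟨⟨_, hB⟩, l', hl', hA', p, hp, q, hq, hpq, hjp, hcq, hlq⟩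
    obtain rfl : l' = l := IsPairPartition.unique hl' hA' hA
    refine ⟨hB, ?_, fun hj => hpq ?_⟩
    · rwa [B.part_eq_of_mem hq hcq]
    · rw [B.part_eq_of_mem hq hcq] at hj
      exact (B.part_eq_of_mem hp hjp).symm.trans (B.part_eq_of_mem hq hj)
  · rintro ⟨hB, hlc, hjc⟩
    refine ⟨⟨hA.card_parts hl, hB⟩, l, hl, hA, B.part j, B.part_mem.2 (Finset.mem_univ _),
      B.part c, B.part_mem.2 (Finset.mem_univ _), fun he => hjc (he ▸ mem_part_self' B j),
      mem_part_self' B j, mem_part_self' B c, hlc⟩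

/-- The coefficients of the second factors. -/
def secondCoeff (c j u : Fin m) (A : MarkedPartition m) : ℤ :=
  if u = j then rootedCoeff (Finset.univ.erase j) c c A
  else - rootedCoeff (Finset.univ.erase u) j u A

/-- The coefficients of the first factors, up to sign. -/
def firstCoeff (r c j u : Fin m) (B : MarkedPartition m) : ℤ :=
  rootedCoeff {r, u} r c B - rootedCoeff {r, u} r j B

open Classical in
theorem secondCoeff_of_isPairPartition {A : MarkedPartition m} {c j l : Fin m} (hl : l ≠ j)
    (hA : IsPairPartition A j l) (u : Fin m) :
    secondCoeff c j u A = (if u = j then 1 else 0) - if u = l then 1 else 0 := by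
  rw [secondCoeff]
  by_cases hu : u = j
  · have hul : u ≠ l := fun h => hl (h ▸ hu)
    rw [if_pos hu, if_pos hu, if_neg hul, rootedCoeff,
      if_pos ⟨((isPairPartition_iff hl).1 hA).1, mem_part_self' A c⟩, sub_zero]
  · rw [if_neg hu, if_neg hu, zero_sub, rootedCoeff]
    congr 1
    refine if_congr ?_ rfl rfl
    rw [← isPairPartition_iff (Ne.symm hu)]
    constructor
    · intro h
      exact IsPairPartition.unique hu h.symm hA
    · rintro rfl
      exact hA.symm

theorem secondCoeff_eq_zero {A : MarkedPartition m} {c j : Fin m}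
    (hA : ¬ ∃ l, l ≠ j ∧ IsPairPartition A j l) (u : Fin m) : secondCoeff c j u A = 0 := by
  rw [secondCoeff]
  by_cases hu : u = j
  · rw [if_pos hu, rootedCoeff, if_neg fun h => hA (exists_isPairPartition h.1)]
  · rw [if_neg hu, rootedCoeff, if_neg, neg_zero]
    intro h
    exact hA ⟨u, hu, ((isPairPartition_iff (Ne.symm hu)).2 h).symm⟩

open Classical in
theorem firstCoeff_of_ne {r u : Fin m} (hru : r ≠ u) (c j : Fin m) (B : MarkedPartition m) :
    firstCoeff r c j u B = (if B.parts.card = 2 ∧ u ∉ B.part r then 1 else 0) *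
      ((if c ∈ B.part r then 1 else 0) - if j ∈ B.part r then 1 else 0) := by
  simp only [firstCoeff, rootedCoeff, isTransversal_pair_iff hru, mem_part_comm (u := r)]
  by_cases h : B.parts.card = 2 ∧ u ∉ B.part r <;> simp [h]

theorem sum_secondCoeff_mul_firstCoeff (r c : Fin (k + 1)) {j : Fin (k + 1)}
    (A B : MarkedPartition (k + 1)) :
    ∑ i, secondCoeff c j (r.succAbove i) A * firstCoeff r c j (r.succAbove i) B =
      permissibleSum c j (A, B) := by
  classical
  let t : Fin (k + 1) → ℤ := fun u =>
    (if B.parts.card = 2 ∧ u ∉ B.part r then 1 else 0) *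
      ((if c ∈ B.part r then 1 else 0) - if j ∈ B.part r then 1 else 0)
  have htr : t r = 0 := by simp [t]
  have h1 : ∑ i, secondCoeff c j (r.succAbove i) A * firstCoeff r c j (r.succAbove i) B =
      ∑ u, secondCoeff c j u A * t u := by
    rw [Fin.sum_univ_succAbove _ r, htr, mul_zero, zero_add]
    exact Finset.sum_congr rfl fun i _ => by rw [firstCoeff_of_ne (Fin.succAbove_ne r i).symm]
  rw [h1, permissibleSum]
  by_cases hA : ∃ l, l ≠ j ∧ IsPairPartition A j l
  · obtain ⟨l, hl, hA⟩ := hA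
    simp only [secondCoeff_of_isPairPartition hl hA, sub_mul, Finset.sum_sub_distrib, ite_mul,
      one_mul, zero_mul, Finset.sum_ite_eq', Finset.mem_univ, if_true,
      isPermissible_iff hl hA, t]
    by_cases hB : B.parts.card = 2
    · simp only [mem_part_iff_of_card_eq_two hB r c]
      by_cases ha : c ∈ B.part r <;> by_cases hb : j ∈ B.part r <;>
        by_cases hd : l ∈ B.part r <;> simp [hB, ha, hb, hd]
    · simp [hB]
  · rw [if_neg]
    · exact Finset.sum_eq_zero fun u _ => by rw [secondCoeff_eq_zero hA, zero_mul]
    · rintro ⟨_, l, hl, hA', _⟩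
      exact hA ⟨l, hl, hA'⟩

theorem isForestExpansion_secondFactor (h : k ≤ N) (r c : Fin (k + 1)) (i j : Fin k) :
    IsForestExpansion (Nat.succ_le_succ h) (secondCoeff c (c.succAbove j) (r.succAbove i))
      (secondFactor (reducedLaplacian h r c) h i j) := by
  by_cases hij : r.succAbove i = c.succAbove j
  · rw [secondFactor_reducedLaplacian_of_eq h hij]
    convert! isForestExpansion_markedMinor h (Finset.mem_erase.2
      ⟨(Fin.succAbove_ne c j).symm, Finset.mem_univ _⟩) c using 1
    funext A
    rw [secondCoeff, if_pos hij]
  · rw [secondFactor_reducedLaplacian_of_ne h hij]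
    convert! (isForestExpansion_markedMinor h (Finset.mem_erase.2
      ⟨Ne.symm hij, Finset.mem_univ _⟩) (r.succAbove i)).C_mul (-1) using 1
    · funext A
      rw [secondCoeff, if_neg hij, neg_one_mul]
    · simp

theorem isForestExpansion_firstFactor (h : k ≤ N) (r c : Fin (k + 1)) (i j : Fin k) :
    IsForestExpansion (Nat.succ_le_succ h)
      (fun B => (-1) ^ (i.val + j.val + (r.val + c.val)) *
        firstCoeff r c (c.succAbove j) (r.succAbove i) B)
      (firstFactor (reducedLaplacian h r c) h i j) := by
  rw [firstFactor_reducedLaplacian]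
  have hr : r ∈ ({r, r.succAbove i} : Finset (Fin (k + 1))) := by simp
  exact ((isForestExpansion_markedMinor h hr c).sub
    (isForestExpansion_markedMinor h hr (c.succAbove j))).C_mul _

theorem isRightSide_iff (h : k ≤ N) (r c : Fin (k + 1)) (j : Fin k) (S : PairSum (k + 1)) :
    IsRightSide h r c j S ↔
      S = (-1 : ℤ) ^ (r.val + c.val) • permissibleSum c (c.succAbove j) := by
  have key : ∑ i : Fin k, (-1 : ℤ) ^ (i.val + j.val) •
      pairProduct (secondCoeff c (c.succAbove j) (r.succAbove i))
        (fun B => (-1) ^ (i.val + j.val + (r.val + c.val)) *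
          firstCoeff r c (c.succAbove j) (r.succAbove i) B) =
      (-1 : ℤ) ^ (r.val + c.val) • permissibleSum c (c.succAbove j) := by
    funext ⟨A, B⟩
    rw [Pi.smul_apply, ← sum_secondCoeff_mul_firstCoeff r, smul_eq_mul, Finset.mul_sum,
      Finset.sum_apply]
    refine Finset.sum_congr rfl fun i _ => ?_
    have hsign : ((-1 : ℤ) ^ (i.val + j.val)) * (-1) ^ (i.val + j.val) = 1 := by
      rw [← mul_pow]; simp
    simp only [Pi.smul_apply, pairProduct, smul_eq_mul]
    rw [pow_add (-1 : ℤ) (i.val + j.val)]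
    linear_combination ((-1) ^ (r.val + c.val) *
      secondCoeff c (c.succAbove j) (r.succAbove i) A *
      firstCoeff r c (c.succAbove j) (r.succAbove i) B) * hsign
  constructor
  · rintro ⟨α, β, hα, hβ, rfl⟩
    rw [← key]
    refine Finset.sum_congr rfl fun i _ => ?_
    rw [(hα i).unique (isForestExpansion_secondFactor h r c i j),
      (hβ i).unique (isForestExpansion_firstFactor h r c i j)]
  · rintro rfl
    exact ⟨_, _, fun i => isForestExpansion_secondFactor h r c i j,
      fun i => isForestExpansion_firstFactor h r c i j, key.symm⟩

theorem mem_part_onePart (u v : Fin (k + 1)) : v ∈ (onePart k).part u := by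
  rw [Finpartition.mem_part_iff_exists]
  exact ⟨Finset.univ, by simp [onePart, Finpartition.indiscrete], by simp, by simp⟩

theorem mem_part_allSingletons (u v : Fin m) : v ∈ (allSingletons m).part u ↔ u = v := by
  rw [allSingletons, Finpartition.mem_part_iff_exists]
  constructor
  · rintro ⟨p, hp, hv, hu⟩
    obtain ⟨w, -, rfl⟩ := Finpartition.mem_bot_iff.1 hp
    rw [Finset.mem_singleton] at hv hu
    rw [hu, hv]
  · rintro rfl
    exact ⟨{u}, Finpartition.mem_bot_iff.2 ⟨u, Finset.mem_univ _, rfl⟩, by simp, by simp⟩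

open Classical in
theorem rootedCoeff_singleton (r c : Fin (k + 1)) (A : MarkedPartition (k + 1)) :
    rootedCoeff {r} r c A = if A = onePart k then 1 else 0 := by
  refine if_congr ?_ rfl rfl
  constructor
  · rintro ⟨⟨h, _⟩, _⟩
    have hr : ∀ u, r ∈ A.part u := fun u => by
      obtain ⟨q, hq, hqu⟩ := h u
      rwa [Finset.mem_singleton.1 hq] at hqu
    exact markedPartition_ext fun u v =>
      iff_of_true (mem_part_trans (hr u) (mem_part_comm.1 (hr v))) (mem_part_onePart u v)
  · rintro rfl
    exact ⟨⟨fun u => ⟨r, by simp, mem_part_onePart u r⟩, by simp⟩, mem_part_onePart _ _⟩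

open Classical in
theorem rootedCoeff_univ (x : Fin m) (B : MarkedPartition m) :
    rootedCoeff Finset.univ x x B = if B = allSingletons m then 1 else 0 := by
  refine if_congr ?_ rfl rfl
  constructor
  · rintro ⟨⟨_, h⟩, _⟩
    refine markedPartition_ext fun u v => ?_
    rw [mem_part_allSingletons]
    refine ⟨h u (Finset.mem_univ _) v (Finset.mem_univ _), ?_⟩
    rintro rfl
    exact mem_part_self' B u
  · rintro rfl
    exact ⟨⟨fun u => ⟨u, Finset.mem_univ _, mem_part_self' _ u⟩,
      fun q _ q' _ hq => (mem_part_allSingletons q q').1 hq⟩, mem_part_self' _ x⟩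

theorem isLeftSide_iff (h : k ≤ N) (r c : Fin (k + 1)) (T : PairSum (k + 1)) :
    IsLeftSide h r c T ↔ T = (-1 : ℤ) ^ (r.val + c.val) • leftMonomial k := by
  classical
  have h1 : IsForestExpansion (Nat.succ_le_succ h)
      (fun A => (-1) ^ (r.val + c.val) * rootedCoeff {r} r c A) (reducedLaplacian h r c).det := by
    rw [det_reducedLaplacian]
    exact (isForestExpansion_markedMinor h (Finset.mem_singleton_self r) c).C_mul _
  have h2 : IsForestExpansion (Nat.succ_le_succ h) (rootedCoeff Finset.univ 0 0)
      (minor (reducedLaplacian h r c) (initialSeg k N) (initialSeg k N)) := by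
    rw [minor_initialSeg_reducedLaplacian]
    exact isForestExpansion_markedMinor h (Finset.mem_univ 0) 0
  have key : pairProduct (fun A => (-1) ^ (r.val + c.val) * rootedCoeff {r} r c A)
      (rootedCoeff Finset.univ 0 0) = (-1 : ℤ) ^ (r.val + c.val) • leftMonomial k := by
    funext ⟨A, B⟩
    simp only [pairProduct, Pi.smul_apply, leftMonomial, rootedCoeff_singleton, rootedCoeff_univ,
      Prod.mk.injEq, smul_eq_mul, mul_assoc]
    congr 1
    by_cases hA : A = onePart k <;> by_cases hB : B = allSingletons (k + 1) <;> simp [hA, hB]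
  constructor
  · rintro ⟨α, β, hα, hβ, rfl⟩
    rw [hα.unique h1, hβ.unique h2, key]
  · rintro rfl
    exact ⟨_, _, h1, h2, key.symm⟩

end Coefficients

/-! ### The identities between spanning forest polynomials -/

section Identities

variable {k N : ℕ}

theorem IsForestExpansion.mul {m n : ℕ} {h : m ≤ n} {α β : MarkedPartition m → ℤ}
    {p q : MvPolynomial (Sym2 (Fin n)) ℤ} (hα : IsForestExpansion h α p)
    (hβ : IsForestExpansion h β q) :
    p * q = ∑ AB : MarkedPartition m × MarkedPartition m,
      MvPolynomial.C (pairProduct α β AB) * (forestSum h AB.1 * forestSum h AB.2) := by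
  rw [hα, hβ, Finset.sum_mul_sum, Fintype.sum_prod_type]
  refine Finset.sum_congr rfl fun A _ => Finset.sum_congr rfl fun B _ => ?_
  rw [pairProduct, MvPolynomial.C_mul]
  ring

theorem forestSum_mul_forestSum (h : k ≤ N) (c : Fin (k + 1)) (j : Fin k) :
    forestSum (Nat.succ_le_succ h) (onePart k) *
        forestSum (Nat.succ_le_succ h) (allSingletons (k + 1)) =
      ∑ AB : MarkedPartition (k + 1) × MarkedPartition (k + 1),
        MvPolynomial.C (permissibleSum c (c.succAbove j) AB) *
          (forestSum (Nat.succ_le_succ h) AB.1 * forestSum (Nat.succ_le_succ h) AB.2) := by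
  classical
  have hsign : (-1 : ℤ) ^ (c.val + c.val) = 1 := by rw [← two_mul]; simp
  obtain ⟨α, β, hα, hβ, hT⟩ := (isLeftSide_iff h c c (leftMonomial k)).2 (by rw [hsign, one_smul])
  obtain ⟨α', β', hα', hβ', hS⟩ := (isRightSide_iff h c c j
    (permissibleSum c (c.succAbove j))).2 (by rw [hsign, one_smul])
  have hdet := det_mul_minor_initialSeg (reducedLaplacian h c c) h j
  rw [hα.mul hβ, ← hT] at hdet
  rw [Finset.sum_eq_single (onePart k, allSingletons (k + 1))] at hdet
  · simp only [leftMonomial, if_true, MvPolynomial.C_1, one_mul] at hdet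
    rw [hdet, hS]
    simp only [(hα' _).mul (hβ' _), Finset.sum_apply, Pi.smul_apply, smul_eq_mul, map_sum,
      MvPolynomial.C_mul, Finset.sum_mul, Finset.mul_sum, map_pow, map_neg, map_one]
    rw [Finset.sum_comm]
    refine Finset.sum_congr rfl fun AB _ => Finset.sum_congr rfl fun i _ => ?_
    ring
  · intro AB _ hne
    simp [leftMonomial, hne]
  · simp

open Classical in
/-- Replacing `a_e` by `a_e⁻¹` for the edges of `G` and by `0` for all other edges, and multiplying
by the product of the edges of `G`, turns `forestSum` into `spanningForestPoly`. -/
theorem map_spanningForestPoly {m n : ℕ} (h : m ≤ n) (G : SimpleGraph (Fin n))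
    (P : MarkedPartition m) {K : Type*} [Field K] (f : MvPolynomial (Sym2 (Fin n)) ℤ →+* K)
    (hf : ∀ e, f (MvPolynomial.X e) ≠ 0) {g : MvPolynomial (Sym2 (Fin n)) ℤ →+* K}
    (hg : ∀ e, g (MvPolynomial.X e) =
      if e ∈ G.edgeFinset then (f (MvPolynomial.X e))⁻¹ else 0) :
    f (spanningForestPoly h G P) =
      (∏ e ∈ G.edgeFinset, f (MvPolynomial.X e)) * g (forestSum h P) := by
  have hsub : compatibleForests h G P ⊆ compatibleForests h ⊤ P := by
    intro F hF
    have hFG : F ⊆ G.edgeFinset := Finset.mem_powerset.1 (Finset.mem_filter.1 hF).1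
    exact mem_compatibleForests_top.2
      ⟨fun e he => G.not_isDiag_of_mem_edgeFinset (hFG he), (Finset.mem_filter.1 hF).2⟩
  rw [forestSum, map_sum, ← Finset.sum_subset hsub, spanningForestPoly, map_sum, Finset.mul_sum]
  · refine Finset.sum_congr rfl fun F hF => ?_
    have hFG : F ⊆ G.edgeFinset := Finset.mem_powerset.1 (Finset.mem_filter.1 hF).1
    have h1 : g (∏ e ∈ F, MvPolynomial.X e) = (∏ e ∈ F, f (MvPolynomial.X e))⁻¹ := by
      rw [map_prod, ← Finset.prod_inv_distrib]
      exact Finset.prod_congr rfl fun e he => by rw [hg, if_pos (hFG he)]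
    rw [h1, map_prod, eq_mul_inv_iff_mul_eq₀ (Finset.prod_ne_zero_iff.2 fun e _ => hf e)]
    exact Finset.prod_sdiff hFG
  · intro F hF hFG
    have hnot : ¬ F ⊆ G.edgeFinset := fun hc =>
      hFG (Finset.mem_filter.2 ⟨Finset.mem_powerset.2 hc, (Finset.mem_filter.1 hF).2⟩)
    obtain ⟨e, heF, heG⟩ := Finset.not_subset.1 hnot
    rw [map_prod]
    exact Finset.prod_eq_zero heF (by rw [hg, if_neg heG])

theorem spanningForestPoly_mul_spanningForestPoly (h : k ≤ N) (c : Fin (k + 1)) (j : Fin k)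
    (G : SimpleGraph (Fin (N + 1))) :
    spanningForestPoly (Nat.succ_le_succ h) G (onePart k) *
        spanningForestPoly (Nat.succ_le_succ h) G (allSingletons (k + 1)) =
      ∑ AB : MarkedPartition (k + 1) × MarkedPartition (k + 1),
        MvPolynomial.C (permissibleSum c (c.succAbove j) AB) *
          (spanningForestPoly (Nat.succ_le_succ h) G AB.1 *
            spanningForestPoly (Nat.succ_le_succ h) G AB.2) := by
  classical
  let K := FractionRing (MvPolynomial (Sym2 (Fin (N + 1))) ℤ)
  let f : MvPolynomial (Sym2 (Fin (N + 1))) ℤ →+* K := algebraMap _ _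
  have hinj : Function.Injective f := IsFractionRing.injective _ _
  let g : MvPolynomial (Sym2 (Fin (N + 1))) ℤ →+* K :=
    MvPolynomial.eval₂Hom (Int.castRingHom K)
      fun e => if e ∈ G.edgeFinset then (f (MvPolynomial.X e))⁻¹ else 0
  have hf : ∀ e, f (MvPolynomial.X e) ≠ 0 := fun e =>
    (map_ne_zero_iff f hinj).2 (MvPolynomial.X_ne_zero e)
  have hg : ∀ e, g (MvPolynomial.X e) =
      if e ∈ G.edgeFinset then (f (MvPolynomial.X e))⁻¹ else 0 := fun e =>
    MvPolynomial.eval₂Hom_X' _ _ e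
  have hP := fun P => map_spanningForestPoly (Nat.succ_le_succ h) G P f hf hg
  have hC : ∀ z : ℤ, f (MvPolynomial.C z) = g (MvPolynomial.C z) := fun z =>
    RingHom.congr_fun (RingHom.ext_int (f.comp MvPolynomial.C) (g.comp MvPolynomial.C)) z
  have hid := congrArg g (forestSum_mul_forestSum h c j)
  apply hinj
  simp only [map_mul, map_sum] at hid ⊢
  simp only [hP, hC]
  rw [mul_mul_mul_comm, hid, Finset.mul_sum]
  refine Finset.sum_congr rfl fun AB _ => ?_
  ring

end Identities

end ColumnExpansion

end

open ColumnExpansion in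
theorem lemma2p5 (k N : ℕ) (h : k ≤ N) (c : Fin (k + 1)) (j : Fin k) :
    -- the right hand side for `r = c` is one copy of each permissible monomial
    (∀ S : PairSum (k + 1),
      IsRightSide h c c j S ↔ S = permissibleSum c (c.succAbove j)) ∧
    -- for any removed row `r`, both sides only change by the common sign `(-1)^(r+c)`
    (∀ (r : Fin (k + 1)) (S : PairSum (k + 1)),
      IsRightSide h r c j S ↔
        S = (-1 : ℤ) ^ (r.val + c.val) • permissibleSum c (c.succAbove j)) ∧
    (∀ (r : Fin (k + 1)) (T : PairSum (k + 1)),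
      IsLeftSide h r c T ↔ T = (-1 : ℤ) ^ (r.val + c.val) • leftMonomial k) ∧
    -- the resulting identity of spanning forest polynomials holds on every graph
    (∀ G : SimpleGraph (Fin (N + 1)),
      spanningForestPoly (Nat.succ_le_succ h) G (onePart k) *
          spanningForestPoly (Nat.succ_le_succ h) G (allSingletons (k + 1)) =
        ∑ AB : MarkedPartition (k + 1) × MarkedPartition (k + 1),
          MvPolynomial.C (permissibleSum c (c.succAbove j) AB) *
            (spanningForestPoly (Nat.succ_le_succ h) G AB.1 *
              spanningForestPoly (Nat.succ_le_succ h) G AB.2)) := by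
  have hsign : (-1 : ℤ) ^ (c.val + c.val) = 1 := by rw [← two_mul]; simp
  refine ⟨fun S => ?_, fun r S => isRightSide_iff h r c j S, fun r T => isLeftSide_iff h r c T,
    fun G => spanningForestPoly_mul_spanningForestPoly h c j G⟩
  rw [isRightSide_iff, hsign, one_smul]
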